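/- Consider online bipartite matching: the servers $S$ are known offline, the requests $R$ arrive one by one, each revealing its set of neighbouring servers, and must be matched irrevocably to an unmatched neighbour or left unmatched. For integers $k, d$ call an instance $(k,d)$-bounded if every server has degree at least $k$ and every request has degree at most $d$. The competitive ratio of a randomized algorithm on $(k,d)$-bounded graphs is the infimum of $\mathbb{E}[\mathrm{ALG}]/\mathrm{OPT}$ over all $(k,d)$-bounded instances with $\mathrm{OPT}>0$, where $\mathrm{ALG}$ is the size of the algorithm's matching and $\mathrm{OPT}$ the size of a maximum matching. Ranking: every server independently draws a rank uniformly from $[0,1]$; each arriving request is matched to its unmatched neighbour of smallest rank (if any). Let $\rho_{\mathrm{Rank}}(k,d)$ be its competitive ratio on $(k,d)$-bounded graphs. OCS-based algorithm: for $d\ge 2$ let $f^*_d(0)=1$ and $$f^*_d(l+1)=f^*_d(l)\cdot\min_{1\le m<d}\left(1+\frac{m f^*_d(l)}{d-m}\right)^{1/m}\qquad(l\ge 0).$$ When a request arrives, let $A$ be the set of its unmatched neighbours; if $A\neq\emptyset$, match it to $s\in A$ with probability $f^*_d(l_s)/\sum_{s'\in A}f^*_d(l_{s'})$, where $l_s$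 is the number of neighbours of $s$ that arrived earlier. Let $\rho_{\mathrm{OCS}}(k,d)$ be its competitive ratio on $(k,d)$-bounded graphs. Then the following hold. 1. There is a $D$ such that for all integers $d\ge D$ and all integers $k>d$, $$\rho_{\mathrm{Rank}}(k,d)\le 1-\frac{(1-1/d)^k(d-1)}{k+d-1}<1-\left(\frac1{3e}\right)^{k/d}\le\rho_{\mathrm{OCS}}(k,d);$$ in particular $\rho_{\mathrm{Rank}}(k,d)<\rho_{\mathrm{OCS}}(k,d)$. 2. Let $\alpha\ge 1$, and let $k_n>d_n$ be natural numbers with $d_n\to\infty$ and $k_n/d_n\to\alpha$. Then for every $\varepsilon>0$ and all sufficiently large $n$, $$\rho_{\mathrm{Rank}}(k_n,d_n)\le 1-\frac{e^{-\alpha}}{\alpha+1}+\varepsilon\quad\text{and}\quad \rho_{\mathrm{OCS}}(k_n,d_n)\ge 1-\left(\frac1{3e}\right)^\alpha-\varepsilon .$$ 3. For all real $\alpha\ge 1$, $\;1-\left(\frac1{3e}\right)^\alpha>1-\frac{e^{-\alpha}}{\alpha+1}$. -/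

import Mathlib

open MeasureTheory

noncomputable section

namespace OnlineMatching

/-- An instance of online bipartite matching: finitely many servers (known offline), finitely many
requests arriving in the order `0, 1, 2, …`, and the set `N(r)` of neighbours of each request. -/
structure Instance where
  servers : ℕ
  requests : ℕ
  nbrs : Fin requests → Finset (Fin servers)

namespace Instance

/-- The degree `d(s) = |N(s)|` of a server. -/
def serverDegree (G : Instance) (s : Fin G.servers) : ℕ :=
  (Finset.univ.filter fun r : Fin G.requests => s ∈ G.nbrs r).card

/-- The number of neighbours of the server `s` among the requests that arrive before round `i`. -/
def degreeBefore (G : Instance) (i : ℕ) (s : Fin G.servers) : ℕ :=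
  (Finset.univ.filter fun r : Fin G.requests => (r : ℕ) < i ∧ s ∈ G.nbrs r).card

/-- `(k, d)`-bounded graphs: every server has degree at least `k`, every request degree at most
`d`. -/
def IsBounded (G : Instance) (k d : ℕ) : Prop :=
  (∀ s, k ≤ G.serverDegree s) ∧ ∀ r, (G.nbrs r).card ≤ d

/-- A matching: a set of edges no two of which share an endpoint. -/
def IsMatching (G : Instance) (M : Finset (Fin G.requests × Fin G.servers)) : Prop :=
  (∀ e ∈ M, e.2 ∈ G.nbrs e.1) ∧
    ∀ e ∈ M, ∀ e' ∈ M, e.1 = e'.1 ∨ e.2 = e'.2 → e = e'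

open Classical in
/-- The size of a maximum matching. -/
def opt (G : Instance) : ℕ :=
  (Finset.univ.filter fun M => G.IsMatching M).sup Finset.card

end Instance

/-- The competitive ratio on `(k, d)`-bounded graphs of an algorithm whose expected matching size
on the instance `G` is `alg G`: the infimum of `alg G / opt G` over all `(k, d)`-bounded instances
(those with `opt G = 0`, for which the ratio is meaningless, are left out). -/
def competitiveRatio (alg : Instance → ℝ) (k d : ℕ) : ℝ :=
  sInf {x : ℝ | ∃ G : Instance, G.IsBounded k d ∧ 0 < G.opt ∧ x = alg G / (G.opt : ℝ)}

/-! ### Ranking -/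

/-- The elements of `A` of smallest rank. -/
def minRank {m : ℕ} (y : Fin m → ℝ) (A : Finset (Fin m)) : Finset (Fin m) :=
  A.filter fun s => ∀ t ∈ A, y s ≤ y t

/-- The set of servers that Ranking has matched when the first `i` requests have been served, for
the rank vector `y`. An arriving request is matched to its unmatched neighbour of smallest rank, if
it has any. (Ties of ranks, which have probability zero, are broken by the index.) -/
def rankingMatched (G : Instance) (y : Fin G.servers → ℝ) : ℕ → Finset (Fin G.servers)
  | 0 => ∅
  | i + 1 =>
    let M := rankingMatched G y i
    if hi : i < G.requests then
      let B := minRank y (G.nbrs ⟨i, hi⟩ \ M)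
      if hB : B.Nonempty then insert (B.min' hB) M else M
    else M

/-- The expected size of the matching of Ranking, with independent ranks uniform in `[0, 1]`. Each
matched server is matched to exactly one request, so the size of the matching is the number of
matched servers. -/
def rankingValue (G : Instance) : ℝ :=
  ∫ y : Fin G.servers → ℝ, ((rankingMatched G y G.requests).card : ℝ)
    ∂(Measure.pi fun _ => volume.restrict (Set.Icc (0 : ℝ) 1))

/-- The competitive ratio of Ranking on `(k, d)`-bounded graphs. -/
def rankingRatio (k d : ℕ) : ℝ := competitiveRatio rankingValue k d

/-! ### The OCS-based algorithm -/

/-- The distribution on the nonempty set `A` that picks `s` with probability proportional to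
`w s`. -/
def weightedChoice {m : ℕ} (w : Fin m → ℝ) (hw : ∀ s, 0 < w s) (A : Finset (Fin m))
    (hA : A.Nonempty) : PMF (Fin m) :=
  PMF.ofFinset (fun s => if s ∈ A then ENNReal.ofReal (w s / ∑ t ∈ A, w t) else 0) A
    (by
      have hpos : 0 < ∑ t ∈ A, w t := Finset.sum_pos (fun t _ => hw t) hA
      rw [Finset.sum_congr rfl (fun s hs => if_pos hs),
        ← ENNReal.ofReal_sum_of_nonneg (fun s _ => (div_pos (hw s) hpos).le),
        ← Finset.sum_div, div_self hpos.ne', ENNReal.ofReal_one])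
    (fun s hs => if_neg hs)

/-- The law of the set of servers that the OCS-based algorithm with the sequence `f` has matched
when the first `i` requests have been served: if the set `A` of unmatched neighbours of the arriving
request is nonempty, the request is matched to `s ∈ A` with probability
`f (l s) / ∑ t ∈ A, f (l t)`, where `l s` is the number of neighbours of `s` that arrived before. -/
def ocsLaw (f : ℕ → ℝ) (hf : ∀ l, 0 < f l) (G : Instance) : ℕ → PMF (Finset (Fin G.servers))
  | 0 => PMF.pure ∅
  | i + 1 =>
    if hi : i < G.requests then
      (ocsLaw f hf G i).bind fun M =>
        if hA : (G.nbrs ⟨i, hi⟩ \ M).Nonempty then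
          (weightedChoice (fun s => f (G.degreeBefore i s)) (fun _ => hf _) _ hA).map
            fun s => insert s M
        else PMF.pure M
    else ocsLaw f hf G i

/-- The expected size of the matching of the OCS-based algorithm with the sequence `f`. -/
def ocsValue (f : ℕ → ℝ) (hf : ∀ l, 0 < f l) (G : Instance) : ℝ :=
  ∑ M : Finset (Fin G.servers), (ocsLaw f hf G G.requests M).toReal * (M.card : ℝ)

/-- The optimal candidate function for `d ≥ 2`: `f 0 = 1` and
`f (l + 1) = f l * min_{1 ≤ m < d} (1 + m * f l / (d - m)) ^ (1 / m)`.
(For `d ≤ 1`, where the range of the minimum is empty, it is the constant `1`.) -/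
def optimalCandidate (d : ℕ) : ℕ → ℝ
  | 0 => 1
  | l + 1 =>
    if h : (Finset.Ico 1 d).Nonempty then
      optimalCandidate d l * (Finset.Ico 1 d).inf' h fun m =>
        (1 + (m : ℝ) * optimalCandidate d l / ((d : ℝ) - (m : ℝ))) ^ ((1 : ℝ) / (m : ℝ))
    else 1

theorem optimalCandidate_pos (d l : ℕ) : 0 < optimalCandidate d l := by
  induction l with
  | zero => simp [optimalCandidate]
  | succ l ih =>
    rw [optimalCandidate]
    split_ifs with h
    · refine mul_pos ih ((Finset.lt_inf'_iff h).2 fun m hm => Real.rpow_pos_of_pos ?_ _)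
      have hmd : (m : ℝ) < (d : ℝ) := by exact_mod_cast (Finset.mem_Ico.1 hm).2
      have : 0 ≤ (m : ℝ) * optimalCandidate d l / ((d : ℝ) - (m : ℝ)) :=
        div_nonneg (mul_nonneg (Nat.cast_nonneg m) ih.le) (sub_nonneg.2 hmd.le)
      linarith
    · exact one_pos

/-- The competitive ratio on `(k, d)`-bounded graphs of the OCS-based algorithm, run with the
optimal candidate function for `d`. -/
def ocsRatio (k d : ℕ) : ℝ :=
  competitiveRatio (ocsValue (optimalCandidate d) (optimalCandidate_pos d)) k d

end OnlineMatching

end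

open MeasureTheory

noncomputable section

namespace OnlineMatching

/-! ### Growth of the optimal candidate function -/

/-! Both algorithms are judged by the probability that a single server stays unmatched.

OCS. The invariant `pmfMean_avoids_le` says that a set `U` is entirely unmatched with probability at
most the product of `1 / f (l s)` over `s ∈ U`. If a request has `m` neighbours in `U`, of total
weight `a`, and the unmatched ones outside `U` weigh `X`, then `U` survives the round with
probability `X / (a + X)`. This is concave in `X`, so it may be replaced by its tangent at `X = d -
m`; the invariant for the sets `U ∪ {t}` bounds the mean of `X` on the survival of `U`, giving the
factor `1 / (1 + a / (d - m))`. The recursion for `f`, with AM-GM (`prod_ratio_le`), is made to pay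
for exactly this factor. Hence every server is matched with probability at least `1 - 1 / f k`, and
OPT is at most the number of servers.

It remains to show `f k ≥ (3e)^(k/d)`. In time `l / d`, `log f` grows at a rate at least the infimum
over `x` of `log (1 + x f / (1 - x)) / x`. As a function of `f` this is an infimum of concave
functions, so chords between a few verified points bound it from below (`IsGrowthRate.chord`). Along
a chord `1 / f` obeys a linear recursion, which can be solved and yields `f d ≥ 3e`; from then on
the rate exceeds `log (3e)`.

Ranking. In `hardInstance` each of the first `k` requests offers all `d - 1` old servers and one
fresh server. An old server survives one such request with probability `1 - 1/d`, and
`ofReal_survivalBound_le` shows that it survives all `k` with probability at least `(1 - 1/d)^k`.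
The later requests never touch old servers, although a perfect matching of the servers exists.

The rest is comparison of the two explicit bounds, which comes down to `e < 3`. -/

/-- If `x ↦ log (1 + (a - 1) x) - log (1 - x) - c x` has its critical points at `r₁ ≤ r₂`, it is
nonnegative on `[0, 1)` as soon as it is so at `r₂`. -/
theorem mul_le_log_sub_log {a c r₁ r₂ : ℝ} (ha : 1 ≤ a) (hc : 0 ≤ c) (h₁ : 0 ≤ r₁) (h₁₂ : r₁ ≤ r₂)
    (h₂ : r₂ < 1)
    (hfac : ∀ x, a - c * ((1 - x) * (1 + (a - 1) * x)) = c * (a - 1) * ((x - r₁) * (x - r₂)))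
    (hr : c * r₂ ≤ Real.log (1 + (a - 1) * r₂) - Real.log (1 - r₂)) {x : ℝ} (hx0 : 0 ≤ x)
    (hx1 : x < 1) : c * x ≤ Real.log (1 + (a - 1) * x) - Real.log (1 - x) := by
  set h : ℝ → ℝ := fun x => Real.log (1 + (a - 1) * x) - Real.log (1 - x) - c * x with hh
  have hpos : ∀ y : ℝ, 0 ≤ y → 0 < 1 + (a - 1) * y := fun y hy => by
    have : 0 ≤ (a - 1) * y := mul_nonneg (by linarith) hy
    linarith
  have hd : ∀ y : ℝ, 0 ≤ y → y < 1 → HasDerivAt h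
      (c * (a - 1) * ((y - r₁) * (y - r₂)) / ((1 - y) * (1 + (a - 1) * y))) y := by
    intro y hy hy1
    have hp := hpos y hy
    have hq : 0 < 1 - y := by linarith
    have e1 : HasDerivAt (fun x : ℝ => 1 + (a - 1) * x) (a - 1) y := by
      simpa using ((hasDerivAt_id y).const_mul (a - 1)).const_add 1
    have e2 : HasDerivAt (fun x : ℝ => 1 - x) (-1) y := by
      simpa using (hasDerivAt_id y).const_sub 1
    have e3 : HasDerivAt (fun x : ℝ => c * x) c y := by
      simpa using (hasDerivAt_id y).const_mul c
    refine (((e1.log hp.ne').sub (e2.log hq.ne')).sub e3).congr_deriv ?_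
    rw [← hfac y]
    field_simp
    ring
  have key : ∀ u v : ℝ, 0 ≤ u → v < 1 → ContinuousOn h (Set.Icc u v) := fun u v hu hv y hy =>
    (hd y (hu.trans hy.1) (hy.2.trans_lt hv)).continuousAt.continuousWithinAt
  have kd : ∀ u v : ℝ, 0 ≤ u → v < 1 → DifferentiableOn ℝ h (interior (Set.Icc u v)) := by
    intro u v hu hv y hy
    have hy := interior_subset hy
    exact (hd y (hu.trans hy.1) (hy.2.trans_lt hv)).differentiableAt.differentiableWithinAt
  have hca : 0 ≤ c * (a - 1) := mul_nonneg hc (by linarith)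
  have hmono : ∀ u v : ℝ, 0 ≤ u → v < 1 → u ≤ v →
      (∀ y ∈ Set.Icc u v, 0 ≤ (y - r₁) * (y - r₂)) → h u ≤ h v := by
    intro u v hu hv huv hs
    refine monotoneOn_of_deriv_nonneg (convex_Icc u v) (key u v hu hv) (kd u v hu hv) ?_
      ⟨le_rfl, huv⟩ ⟨huv, le_rfl⟩ huv
    intro y hy
    have hy := interior_subset hy
    have hy0 := hu.trans hy.1
    have hy1 := hy.2.trans_lt hv
    rw [(hd y hy0 hy1).deriv]
    exact div_nonneg (mul_nonneg hca (hs y hy)) (mul_nonneg (by linarith) (hpos y hy0).le)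
  have hanti : ∀ u v : ℝ, 0 ≤ u → v < 1 → u ≤ v →
      (∀ y ∈ Set.Icc u v, (y - r₁) * (y - r₂) ≤ 0) → h v ≤ h u := by
    intro u v hu hv huv hs
    refine antitoneOn_of_deriv_nonpos (convex_Icc u v) (key u v hu hv) (kd u v hu hv) ?_
      ⟨le_rfl, huv⟩ ⟨huv, le_rfl⟩ huv
    intro y hy
    have hy := interior_subset hy
    have hy0 := hu.trans hy.1
    have hy1 := hy.2.trans_lt hv
    rw [(hd y hy0 hy1).deriv]
    exact div_nonpos_of_nonpos_of_nonneg (mul_nonpos_of_nonneg_of_nonpos hca (hs y hy))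
      (mul_nonneg (by linarith) (hpos y hy0).le)
  suffices 0 ≤ h x by simp only [hh] at this; linarith
  have hr2 : 0 ≤ h r₂ := by simp only [hh]; linarith
  have h0 : h 0 = 0 := by simp [hh]
  rcases le_total x r₁ with hxr | hxr
  · rw [← h0]
    exact hmono 0 x le_rfl hx1 hx0 fun y hy =>
      mul_nonneg_of_nonpos_of_nonpos (by linarith [hy.2]) (by linarith [hy.2])
  rcases le_total x r₂ with hxr2 | hxr2
  · exact hr2.trans (hanti x r₂ hx0 h₂ hxr2 fun y hy =>
      mul_nonpos_of_nonneg_of_nonpos (by linarith [hy.1]) (by linarith [hy.2]))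
  · exact hr2.trans (hmono r₂ x (h₁.trans h₁₂) hx1 hxr2 fun y hy =>
      mul_nonneg (by linarith [hy.1]) (by linarith [hy.1]))

/-- `G` bounds from below the continuous-time growth rate of the candidate function at value `f`. -/
def IsGrowthRate (f G : ℝ) : Prop :=
  ∀ x : ℝ, 0 < x → x < 1 → x * G ≤ Real.log (1 + x * f / (1 - x))

theorem isGrowthRate_of_log {f G : ℝ} (hf : 1 ≤ f)
    (h : ∀ x : ℝ, 0 ≤ x → x < 1 → G * x ≤ Real.log (1 + (f - 1) * x) - Real.log (1 - x)) :
    IsGrowthRate f G := by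
  intro x hx0 hx1
  have h1 : 0 < 1 - x := by linarith
  have h2 : 0 < 1 + (f - 1) * x := by
    have : 0 ≤ (f - 1) * x := mul_nonneg (by linarith) hx0.le
    linarith
  have : 1 + x * f / (1 - x) = (1 + (f - 1) * x) / (1 - x) := by
    field_simp; ring
  rw [this, Real.log_div h2.ne' h1.ne', mul_comm]
  exact h x hx0.le hx1

theorem isGrowthRate_zero : IsGrowthRate 0 0 := by
  intro x _ _
  simp

/-- At the values 2, 4 and 17/2 the rates 2, 16/5 and 17/4 are chosen to make both critical points
rational. What remains is one evaluation at the larger critical point: trivial for 2, then `log 5 ≥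
8/5` and `log 18 ≥ 17/6`. -/
theorem isGrowthRate_two : IsGrowthRate 2 2 := by
  refine isGrowthRate_of_log (by norm_num) fun x hx0 hx1 => ?_
  refine mul_le_log_sub_log (r₁ := 0) (r₂ := 0) (by norm_num) (by norm_num) le_rfl le_rfl
    (by norm_num) (fun x => by ring) (by simp) hx0 hx1

theorem isGrowthRate_four : IsGrowthRate 4 (16 / 5) := by
  refine isGrowthRate_of_log (by norm_num) fun x hx0 hx1 => ?_
  refine mul_le_log_sub_log (r₁ := 1 / 6) (r₂ := 1 / 2) (by norm_num) (by norm_num) (by norm_num)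
    (by norm_num) (by norm_num) (fun x => by ring) ?_ hx0 hx1
  rw [← Real.log_div (by norm_num) (by norm_num)]
  have : (1 + (4 - 1) * (1 / 2) : ℝ) / (1 - 1 / 2) = 5 := by norm_num
  rw [this]
  linarith [Real.log_five_gt_d9]

theorem isGrowthRate_seventeen_halves : IsGrowthRate (17 / 2) (17 / 4) := by
  refine isGrowthRate_of_log (by norm_num) fun x hx0 hx1 => ?_
  refine mul_le_log_sub_log (r₁ := 1 / 5) (r₂ := 2 / 3) (by norm_num) (by norm_num) (by norm_num)
    (by norm_num) (by norm_num) (fun x => by ring) ?_ hx0 hx1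
  rw [← Real.log_div (by norm_num) (by norm_num)]
  have : (1 + (17 / 2 - 1) * (2 / 3) : ℝ) / (1 - 2 / 3) = 2 * (3 * 3) := by norm_num
  rw [this, Real.log_mul (by norm_num) (by norm_num), Real.log_mul (by norm_num) (by norm_num)]
  linarith [Real.log_three_gt_d9, Real.log_two_gt_d9]

theorem IsGrowthRate.mono {f f' G : ℝ} (h : IsGrowthRate f G) (hf : 0 ≤ f) (hff' : f ≤ f') :
    IsGrowthRate f' G := by
  intro x hx0 hx1
  have h1 : 0 < 1 - x := by linarith
  refine (h x hx0 hx1).trans (Real.log_le_log ?_ ?_)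
  · have : 0 ≤ x * f / (1 - x) := by positivity
    linarith
  · gcongr

/-- Growth rates are concave in the value, because the logarithm is. -/
theorem IsGrowthRate.chord {a b A B f : ℝ} (hA : IsGrowthRate a A) (hB : IsGrowthRate b B)
    (ha : 0 ≤ a) (hab : a < b) (haf : a ≤ f) (hfb : f ≤ b) :
    IsGrowthRate f (A + (B - A) * ((f - a) / (b - a))) := by
  intro x hx0 hx1
  have h1 : 0 < 1 - x := by linarith
  have hba : 0 < b - a := by linarith
  set t := (f - a) / (b - a) with ht
  have ht0 : 0 ≤ t := div_nonneg (by linarith) hba.le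
  have ht1 : t ≤ 1 := (div_le_one hba).2 (by linarith)
  have hf : f = (1 - t) * a + t * b := by
    rw [ht]; field_simp; ring
  have hp : ∀ y : ℝ, 0 ≤ y → 0 < 1 + x * y / (1 - x) := fun y hy => by
    have : 0 ≤ x * y / (1 - x) := by positivity
    linarith
  have := strictConcaveOn_log_Ioi.concaveOn.2 (hp a ha) (hp b (ha.trans hab.le))
    (sub_nonneg.2 ht1) ht0 (by ring)
  simp only [smul_eq_mul] at this
  have e : (1 - t) * (1 + x * a / (1 - x)) + t * (1 + x * b / (1 - x)) = 1 + x * f / (1 - x) := by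
    rw [hf]; ring
  rw [e] at this
  refine le_trans ?_ this
  nlinarith [mul_le_mul_of_nonneg_left (hA x hx0 hx1) (sub_nonneg.2 ht1),
    mul_le_mul_of_nonneg_left (hB x hx0 hx1) ht0]

/-! ### From growth rates to the size of the candidate function -/

theorem optimalCandidate_succ_le {d m : ℕ} (hm : 1 ≤ m) (hmd : m < d) (l : ℕ) :
    optimalCandidate d (l + 1) ≤ optimalCandidate d l *
      (1 + (m : ℝ) * optimalCandidate d l / ((d : ℝ) - (m : ℝ))) ^ ((1 : ℝ) / (m : ℝ)) := by
  have h : (Finset.Ico 1 d).Nonempty := ⟨m, Finset.mem_Ico.2 ⟨hm, hmd⟩⟩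
  rw [optimalCandidate, dif_pos h]
  exact mul_le_mul_of_nonneg_left (Finset.inf'_le _ (Finset.mem_Ico.2 ⟨hm, hmd⟩))
    (optimalCandidate_pos d l).le

/-- With `x = m / d`, the `m`-th term of the minimum is the exponential of `log (1 + x f / (1 - x))
/ (x d)`, so a growth rate bounds all terms at once. -/
theorem mul_exp_le_optimalCandidate_succ {d : ℕ} (hd : 2 ≤ d) {l : ℕ} {G : ℝ}
    (hG : IsGrowthRate (optimalCandidate d l) G) :
    optimalCandidate d l * Real.exp (G / d) ≤ optimalCandidate d (l + 1) := by
  have h : (Finset.Ico 1 d).Nonempty := ⟨1, Finset.mem_Ico.2 ⟨le_rfl, hd⟩⟩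
  rw [optimalCandidate, dif_pos h]
  have hf := optimalCandidate_pos d l
  refine mul_le_mul_of_nonneg_left ((Finset.le_inf'_iff h _).2 fun m hm => ?_) hf.le
  have hm1 := (Finset.mem_Ico.1 hm).1
  have hm0 : (0 : ℝ) < m := by exact_mod_cast hm1
  have hmd : (m : ℝ) < d := by exact_mod_cast (Finset.mem_Ico.1 hm).2
  have hd0 : (0 : ℝ) < d := hm0.trans hmd
  have hdm : (0 : ℝ) < d - m := sub_pos.2 hmd
  have hpos : 0 < 1 + (m : ℝ) * optimalCandidate d l / ((d : ℝ) - m) := by positivity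
  rw [Real.rpow_def_of_pos hpos]
  refine Real.exp_le_exp.2 ?_
  have := hG ((m : ℝ) / d) (by positivity) ((div_lt_one hd0).2 hmd)
  have e : (m : ℝ) / d * optimalCandidate d l / (1 - m / d) =
      m * optimalCandidate d l / (d - m) := by
    field_simp
  rw [e] at this
  calc G / d = (m / d * G) * (1 / m) := by field_simp
    _ ≤ _ := mul_le_mul_of_nonneg_right this (by positivity)

theorem optimalCandidate_le_succ {d : ℕ} (hd : 2 ≤ d) (l : ℕ) :
    optimalCandidate d l ≤ optimalCandidate d (l + 1) := by
  have := mul_exp_le_optimalCandidate_succ hd (l := l)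
    (isGrowthRate_zero.mono le_rfl (optimalCandidate_pos d l).le)
  simpa using this

theorem optimalCandidate_monotone {d : ℕ} (hd : 2 ≤ d) : Monotone (optimalCandidate d) :=
  monotone_nat_of_le_succ (optimalCandidate_le_succ hd)

/-- One step of growth at the rate `p + s f`, seen on `1 / f`. -/
theorem inv_le_of_growth {f f' p s X d : ℝ} (hf : 0 < f) (hd : 0 < d) (hp : 0 ≤ p) (hs : 0 ≤ s)
    (hX : p + s * f ≤ X) (h : f * Real.exp ((p + s * f) / d) ≤ f') :
    f'⁻¹ ≤ f⁻¹ - (1 - X / d) * (p * f⁻¹ + s) / d := by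
  set x := (p + s * f) / d with hx
  have hx0 : 0 ≤ x := by positivity
  have hxX : x ≤ X / d := by rw [hx]; gcongr
  -- In continuous time `w = 1 / f` satisfies the linear equation `w' = -(p w + s) / d`. Here the
  -- exponential is weakened to `1 + x`, and the factor `1 - X / d` absorbs the second-order error
  -- of `1 / (1 + x)`.
  have h1 : f * (1 + x) ≤ f' := le_trans (by
    have := Real.add_one_le_exp x
    gcongr; linarith) h
  have h2 : f'⁻¹ ≤ (f * (1 + x))⁻¹ := inv_anti₀ (by positivity) h1
  refine h2.trans ?_
  have e : (p * f⁻¹ + s) / d = f⁻¹ * x := by rw [hx]; field_simp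
  rw [mul_div_assoc, e, mul_inv]
  have h3 : (1 + x)⁻¹ ≤ 1 - (1 - X / d) * x := by
    rw [inv_le_iff_one_le_mul₀ (by positivity)]
    nlinarith [mul_le_mul_of_nonneg_right hxX hx0, mul_nonneg hx0 hx0,
      mul_nonneg (sub_nonneg.2 hxX) (mul_nonneg hx0 hx0)]
  calc f⁻¹ * (1 + x)⁻¹ ≤ f⁻¹ * (1 - (1 - X / d) * x) := by gcongr
    _ = _ := by ring

/-- Growth at the rate `s f`. -/
theorem reach_of_linear_growth {f : ℕ → ℝ} (hf : ∀ l, 0 < f l) (hmono : Monotone f) {a b s θ d : ℝ}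
    (ha : 0 < a) (hd : 0 < d) (hs : 0 ≤ s) (hθ : θ ≤ 1 - s * b / d)
    (hstep : ∀ l, a ≤ f l → f l ≤ b → f l * Real.exp ((s * f l) / d) ≤ f (l + 1))
    {l₀ : ℕ} (hl₀ : a ≤ f l₀) (j : ℕ) :
    b ≤ f (l₀ + j) ∨ (f (l₀ + j))⁻¹ ≤ a⁻¹ - θ * s / d * j := by
  induction j with
  | zero => right; simpa using inv_anti₀ ha hl₀
  | succ j ih =>
    rcases ih with ih | ih
    · exact Or.inl (ih.trans (hmono (by omega)))
    rcases le_total b (f (l₀ + j)) with hb | hb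
    · exact Or.inl (hb.trans (hmono (by omega)))
    right
    have hst := hstep (l₀ + j) (hl₀.trans (hmono (by omega))) hb
    have := inv_le_of_growth (f' := f (l₀ + j + 1)) (X := s * b) (p := 0) (hf (l₀ + j)) hd le_rfl hs
      (by rw [zero_add]; gcongr) (by rw [zero_add]; exact hst)
    have h2 : θ * s / d ≤ (1 - s * b / d) * (0 * (f (l₀ + j))⁻¹ + s) / d := by
      rw [zero_mul, zero_add]; gcongr
    rw [← add_assoc]
    push_cast
    linarith

/-- Growth at the rate `p + s f`. -/
theorem reach_of_affine_growth {f : ℕ → ℝ} (hf : ∀ l, 0 < f l) (hmono : Monotone f)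
    {a b p s θ d : ℝ} (ha : 0 < a) (hd : 0 < d) (hp : 0 ≤ p) (hs : 0 ≤ s)
    (hθ : θ ≤ 1 - (p + s * b) / d)
    (hstep : ∀ l, a ≤ f l → f l ≤ b → f l * Real.exp ((p + s * f l) / d) ≤ f (l + 1))
    {l₀ : ℕ} (hl₀ : a ≤ f l₀) (j : ℕ) :
    b ≤ f (l₀ + j) ∨
      p * (f (l₀ + j))⁻¹ + s ≤ (p * a⁻¹ + s) * Real.exp (-(p * θ / d * j)) := by
  induction j with
  | zero =>
    right
    have := inv_anti₀ ha hl₀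
    simp only [add_zero, Nat.cast_zero, mul_zero, neg_zero, Real.exp_zero, mul_one]
    gcongr
  | succ j ih =>
    rcases ih with ih | ih
    · exact Or.inl (ih.trans (hmono (by omega)))
    rcases le_total b (f (l₀ + j)) with hb | hb
    · exact Or.inl (hb.trans (hmono (by omega)))
    right
    have hst := hstep (l₀ + j) (hl₀.trans (hmono (by omega))) hb
    have := inv_le_of_growth (X := p + s * b) (hf _) hd hp hs (by gcongr) hst
    rw [← add_assoc]
    set w := (f (l₀ + j))⁻¹ with hw
    have hw0 : 0 < w := inv_pos.2 (hf _)
    have h2 : θ * (p * w + s) / d ≤ (1 - (p + s * b) / d) * (p * w + s) / d := by gcongr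
    have h3 : p * (f (l₀ + j + 1))⁻¹ + s ≤ (p * w + s) * (1 - p * θ / d) := by
      have := mul_le_mul_of_nonneg_left (this.trans (sub_le_sub_left h2 w)) hp
      calc _ ≤ p * (w - θ * (p * w + s) / d) + s := by linarith
        _ = _ := by ring
    refine h3.trans ?_
    have h4 : 1 - p * θ / d ≤ Real.exp (-(p * θ / d)) := Real.one_sub_le_exp_neg _
    calc (p * w + s) * (1 - p * θ / d) ≤ (p * w + s) * Real.exp (-(p * θ / d)) := by gcongr
      _ ≤ (p * a⁻¹ + s) * Real.exp (-(p * θ / d * j)) * Real.exp (-(p * θ / d)) := by gcongr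
      _ = _ := by
        rw [mul_assoc, ← Real.exp_add]
        push_cast
        ring_nf

/-- The growth from 1 to 2, 4 and 204/25 follows three chords, with rates `f`, `4/5 + 3/5 f` and
`34/15 + 7/30 f`. The integrals of `1 / (f · rate)` are `1/2`, `5/4 log (5/4) ≈ 0.279` and `15/34
log (36/23) ≈ 0.198`, of sum less than 1. -/
theorem three_mul_exp_one_le_optimalCandidate {d : ℕ} (hd : 10000 ≤ d) :
    3 * Real.exp 1 ≤ optimalCandidate d d := by
  have hd2 : 2 ≤ d := by omega
  have hdR : (10000 : ℝ) ≤ d := by exact_mod_cast hd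
  have hd0 : (0 : ℝ) < d := by linarith
  have hmono := optimalCandidate_monotone hd2
  have hf := optimalCandidate_pos d
  have hceil : ∀ c : ℝ, 0 ≤ c → c * d ≤ (⌈c * d⌉₊ : ℝ) ∧ (⌈c * d⌉₊ : ℝ) < c * d + 1 := fun c hc =>
    ⟨Nat.le_ceil _, Nat.ceil_lt_add_one (by positivity)⟩
  -- The three times rounded up, with room for discretisation; they add up to 0.981, and the
  -- remainder covers the three ceilings.
  obtain ⟨a1, b1⟩ := hceil (501 / 1000) (by norm_num)
  obtain ⟨a2, b2⟩ := hceil (28 / 100) (by norm_num)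
  obtain ⟨a3, b3⟩ := hceil (1 / 5) (by norm_num)
  set j₁ := ⌈(501 / 1000 : ℝ) * d⌉₊
  set j₂ := ⌈(28 / 100 : ℝ) * d⌉₊
  set j₃ := ⌈(1 / 5 : ℝ) * d⌉₊
  -- All rates in use are at most 5, so the discretisation costs a factor of at least 999/1000.
  have hθ : ∀ X : ℝ, X ≤ 5 → (999 / 1000 : ℝ) ≤ 1 - X / d := fun X hX => by
    have : X / d ≤ 1 / 1000 := by
      rw [div_le_iff₀ hd0]; linarith
    linarith
  have phase₁ : 2 ≤ optimalCandidate d j₁ := by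
    have := reach_of_linear_growth hf hmono (a := 1) (b := 2) (s := 1) (θ := 999 / 1000) one_pos hd0
      zero_le_one (hθ _ (by norm_num)) (fun l _ h2 => ?_) (l₀ := 0) (by simp [optimalCandidate]) j₁
    · rw [zero_add] at this
      rcases this with h | h
      · exact h
      have h3 : (999 / 1000 : ℝ) * 1 / d * j₁ ≥ 1 / 2 := by
        rw [ge_iff_le, mul_one, div_mul_eq_mul_div, le_div_iff₀ hd0]
        linarith
      have h4 : (optimalCandidate d j₁)⁻¹ ≤ 2⁻¹ := by linarith
      exact (inv_le_inv₀ (hf _) (by norm_num)).1 h4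
    · refine mul_exp_le_optimalCandidate_succ hd2 ?_
      convert isGrowthRate_zero.chord isGrowthRate_two le_rfl two_pos (hf l).le h2 using 1
      ring
  have phase₂ : 4 ≤ optimalCandidate d (j₁ + j₂) := by
    have := reach_of_affine_growth hf hmono (a := 2) (b := 4) (p := 4 / 5) (s := 3 / 5)
      (θ := 999 / 1000) two_pos hd0 (by norm_num) (by norm_num) (hθ _ (by norm_num))
      (fun l h1 h2 => ?_) phase₁ j₂
    · rcases this with h | h
      · exact h
      have h3 : Real.log 5 - 2 * Real.log 2 ≤ 4 / 5 * (999 / 1000 : ℝ) / d * j₂ := by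
        rw [div_mul_eq_mul_div, le_div_iff₀ hd0]
        have : Real.log 5 - 2 * Real.log 2 ≤ 0.22315 := by
          linarith [Real.log_five_lt_d9, Real.log_two_gt_d9]
        nlinarith
      have h5 : Real.exp (-(4 / 5 * (999 / 1000 : ℝ) / d * j₂)) ≤ 4 / 5 := by
        refine (Real.exp_le_exp.2 (neg_le_neg h3)).trans_eq ?_
        have : -(Real.log 5 - 2 * Real.log 2) = Real.log (4 / 5) := by
          rw [show (4 / 5 : ℝ) = 2 * 2 / 5 by norm_num, Real.log_div (by norm_num) (by norm_num),
            Real.log_mul (by norm_num) (by norm_num)]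
          ring
        rw [this, Real.exp_log (by norm_num)]
      have h4 : (optimalCandidate d (j₁ + j₂))⁻¹ ≤ 4⁻¹ := by linarith
      exact (inv_le_inv₀ (hf _) (by norm_num)).1 h4
    · refine mul_exp_le_optimalCandidate_succ hd2 ?_
      convert isGrowthRate_two.chord isGrowthRate_four two_pos.le (by norm_num) h1 h2 using 1
      ring
  -- The target 8.16 lies just above `3e ≈ 8.155`. Reaching it means that `p / f + s` falls from 4/5
  -- to 23/45, a factor of 23/36.
  have phase₃ : 204 / 25 ≤ optimalCandidate d (j₁ + j₂ + j₃) := by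
    have := reach_of_affine_growth hf hmono (a := 4) (b := 204 / 25) (p := 34 / 15) (s := 7 / 30)
      (θ := 999 / 1000) four_pos hd0 (by norm_num) (by norm_num) (hθ _ (by norm_num))
      (fun l h1 h2 => ?_) phase₂ j₃
    · rcases this with h | h
      · exact h
      have h3 : (45 / 100 : ℝ) ≤ 34 / 15 * (999 / 1000 : ℝ) / d * j₃ := by
        rw [div_mul_eq_mul_div, le_div_iff₀ hd0]
        nlinarith
      have h5 : Real.exp (-(34 / 15 * (999 / 1000 : ℝ) / d * j₃)) ≤ 23 / 36 := by
        refine (Real.exp_le_exp.2 (neg_le_neg h3)).trans ?_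
        rw [Real.exp_neg, inv_le_comm₀ (Real.exp_pos _) (by norm_num)]
        refine le_trans ?_ (Real.sum_le_exp_of_nonneg (by norm_num) 5)
        norm_num [Finset.sum_range_succ, Nat.factorial]
      have h4 : (optimalCandidate d (j₁ + j₂ + j₃))⁻¹ ≤ (204 / 25)⁻¹ := by
        norm_num at h ⊢
        linarith
      exact (inv_le_inv₀ (hf _) (by norm_num)).1 h4
    · refine mul_exp_le_optimalCandidate_succ hd2 ?_
      convert isGrowthRate_four.chord isGrowthRate_seventeen_halves four_pos.le (by norm_num) h1
        (h2.trans (by norm_num)) using 1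
      ring
  have hle : j₁ + j₂ + j₃ ≤ d := by
    have : ((j₁ + j₂ + j₃ : ℕ) : ℝ) ≤ d := by push_cast; linarith
    exact_mod_cast this
  linarith [hmono hle, Real.exp_one_lt_d9]

/-- Beyond `l = d` the value is at least 4, where the rate 16/5 already exceeds `log (3e) = 1 + log
3`. -/
theorem rpow_le_optimalCandidate {d k : ℕ} (hd : 10000 ≤ d) (hk : d ≤ k) :
    (3 * Real.exp 1) ^ ((k : ℝ) / d) ≤ optimalCandidate d k := by
  have hd2 : 2 ≤ d := by omega
  have hd0 : (0 : ℝ) < d := by exact_mod_cast (by omega : 0 < d)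
  have h3e : (0 : ℝ) < 3 * Real.exp 1 := by positivity
  induction k, hk using Nat.le_induction with
  | base =>
    rw [div_self hd0.ne', Real.rpow_one]
    exact three_mul_exp_one_le_optimalCandidate hd
  | succ k hk ih =>
    have h4 : 4 ≤ optimalCandidate d k := by
      have := optimalCandidate_monotone hd2 hk
      linarith [three_mul_exp_one_le_optimalCandidate hd, Real.exp_one_gt_d9]
    have hG := mul_exp_le_optimalCandidate_succ hd2 (isGrowthRate_four.mono four_pos.le h4)
    refine le_trans ?_ hG
    have hlog : Real.log (3 * Real.exp 1) ≤ 16 / 5 := by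
      rw [Real.log_mul (by norm_num) (Real.exp_pos 1).ne', Real.log_exp]
      linarith [Real.log_three_lt_d9]
    push_cast
    rw [add_div, Real.rpow_add h3e]
    refine mul_le_mul ih ?_ (by positivity) (optimalCandidate_pos d k).le
    rw [Real.rpow_def_of_pos h3e]
    refine Real.exp_le_exp.2 ?_
    rw [mul_one_div]
    gcongr

/-! ### Expectations over finite types -/

/-- The expectation of `φ` under a distribution on a finite type. -/
def pmfMean {β : Type*} [Fintype β] (p : PMF β) (φ : β → ℝ) : ℝ := ∑ b, (p b).toReal * φ b

section pmfMean

variable {β γ : Type*} [Fintype β] [Fintype γ]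

theorem sum_toReal_eq_one (p : PMF β) : ∑ b, (p b).toReal = 1 := by
  have h := p.tsum_coe
  rw [tsum_fintype] at h
  rw [← ENNReal.toReal_sum fun b _ => p.apply_ne_top b, h, ENNReal.toReal_one]

theorem pmfMean_const (p : PMF β) (c : ℝ) : pmfMean p (fun _ => c) = c := by
  rw [pmfMean, ← Finset.sum_mul, sum_toReal_eq_one, one_mul]

theorem pmfMean_mono (p : PMF β) {φ ψ : β → ℝ} (h : ∀ b, φ b ≤ ψ b) :
    pmfMean p φ ≤ pmfMean p ψ :=
  Finset.sum_le_sum fun b _ => mul_le_mul_of_nonneg_left (h b) ENNReal.toReal_nonneg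

theorem pmfMean_sum {ι : Type*} (p : PMF β) (s : Finset ι) (φ : ι → β → ℝ) :
    pmfMean p (fun b => ∑ i ∈ s, φ i b) = ∑ i ∈ s, pmfMean p (φ i) := by
  simp only [pmfMean, Finset.mul_sum]
  exact Finset.sum_comm

theorem pmfMean_const_mul (p : PMF β) (c : ℝ) (φ : β → ℝ) :
    pmfMean p (fun b => c * φ b) = c * pmfMean p φ := by
  simp only [pmfMean, Finset.mul_sum]
  exact Finset.sum_congr rfl fun b _ => by ring

theorem pmfMean_add (p : PMF β) (φ ψ : β → ℝ) :
    pmfMean p (fun b => φ b + ψ b) = pmfMean p φ + pmfMean p ψ := by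
  simp only [pmfMean, mul_add, Finset.sum_add_distrib]

theorem pmfMean_sub (p : PMF β) (φ ψ : β → ℝ) :
    pmfMean p (fun b => φ b - ψ b) = pmfMean p φ - pmfMean p ψ := by
  simp only [pmfMean, mul_sub, Finset.sum_sub_distrib]

theorem pmfMean_pure [DecidableEq β] (a : β) (φ : β → ℝ) : pmfMean (PMF.pure a) φ = φ a := by
  rw [pmfMean, Finset.sum_eq_single a]
  · simp
  · intro b _ hb
    simp [hb]
  · simp

theorem pmfMean_bind (p : PMF β) (K : β → PMF γ) (φ : γ → ℝ) :
    pmfMean (p.bind K) φ = pmfMean p fun b => pmfMean (K b) φ := by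
  have h : ∀ c, ((p.bind K) c).toReal = ∑ b, (p b).toReal * (K b c).toReal := by
    intro c
    rw [PMF.bind_apply, tsum_fintype, ENNReal.toReal_sum]
    · simp [ENNReal.toReal_mul]
    · exact fun b _ => ENNReal.mul_ne_top (p.apply_ne_top b) ((K b).apply_ne_top c)
  simp only [pmfMean, h, Finset.sum_mul, Finset.mul_sum]
  rw [Finset.sum_comm]
  exact Finset.sum_congr rfl fun b _ => Finset.sum_congr rfl fun c _ => by ring

theorem pmfMean_map [DecidableEq γ] (p : PMF β) (g : β → γ) (φ : γ → ℝ) :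
    pmfMean (p.map g) φ = pmfMean p fun b => φ (g b) := by
  rw [← PMF.bind_pure_comp, pmfMean_bind]
  simp only [Function.comp, pmfMean_pure]

end pmfMean

theorem pmfMean_weightedChoice {m : ℕ} (w : Fin m → ℝ) (hw : ∀ s, 0 < w s) (A : Finset (Fin m))
    (hA : A.Nonempty) (φ : Fin m → ℝ) :
    pmfMean (weightedChoice w hw A hA) φ = (∑ s ∈ A, w s * φ s) / ∑ s ∈ A, w s := by
  have hpos : 0 < ∑ t ∈ A, w t := Finset.sum_pos (fun t _ => hw t) hA
  have h : ∀ s, (weightedChoice w hw A hA s).toReal * φ s =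
      if s ∈ A then w s * φ s / ∑ t ∈ A, w t else 0 := by
    intro s
    rw [weightedChoice, PMF.ofFinset_apply]
    split_ifs
    · rw [ENNReal.toReal_ofReal (div_pos (hw s) hpos).le]
      ring
    · simp
  rw [pmfMean, Finset.sum_congr rfl fun s _ => h s, ← Finset.sum_filter, Finset.filter_mem_eq_inter,
    Finset.univ_inter, Finset.sum_div]

/-! ### The probability that a set of servers is unmatched -/

/-- `1` if no server of `U` is in `M`, else `0`. -/
def avoids {m : ℕ} (U M : Finset (Fin m)) : ℝ := if Disjoint U M then 1 else 0

theorem avoids_nonneg {m : ℕ} (U M : Finset (Fin m)) : 0 ≤ avoids U M := by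
  rw [avoids]; split_ifs <;> norm_num

theorem avoids_insert_left {m : ℕ} (t : Fin m) (U M : Finset (Fin m)) :
    avoids (insert t U) M = avoids U M * if t ∈ M then 0 else 1 := by
  simp only [avoids, Finset.disjoint_insert_left]
  split_ifs <;> simp_all

theorem avoids_insert_right {m : ℕ} (t : Fin m) (U M : Finset (Fin m)) :
    avoids U (insert t M) = avoids U M * if t ∈ U then 0 else 1 := by
  simp only [avoids, Finset.disjoint_insert_right]
  split_ifs <;> simp_all

theorem degreeBefore_zero (G : Instance) (s : Fin G.servers) : G.degreeBefore 0 s = 0 := by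
  simp [Instance.degreeBefore]

theorem degreeBefore_succ (G : Instance) {i : ℕ} (hi : i < G.requests) (s : Fin G.servers) :
    G.degreeBefore (i + 1) s = G.degreeBefore i s + if s ∈ G.nbrs ⟨i, hi⟩ then 1 else 0 := by
  unfold Instance.degreeBefore
  have : (Finset.univ.filter fun r : Fin G.requests => (r : ℕ) < i + 1 ∧ s ∈ G.nbrs r) =
      (Finset.univ.filter fun r : Fin G.requests => (r : ℕ) < i ∧ s ∈ G.nbrs r) ∪
        if s ∈ G.nbrs ⟨i, hi⟩ then {⟨i, hi⟩} else ∅ := by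
    ext r
    simp only [Finset.mem_filter, Finset.mem_univ, true_and, Finset.mem_union]
    have hr : (r : ℕ) = i ↔ r = ⟨i, hi⟩ := by rw [Fin.ext_iff]
    by_cases h : r = ⟨i, hi⟩
    · subst h
      simp only [Nat.lt_succ_self, true_and, lt_irrefl, false_and, false_or]
      split_ifs with h2 <;> simp [h2]
    · have h1 : (r : ℕ) ≠ i := fun h' => h (hr.1 h')
      have h2 : (r : ℕ) < i + 1 ↔ (r : ℕ) < i := by omega
      rw [h2]
      split_ifs <;> simp [h]
  rw [this, Finset.card_union_of_disjoint]
  · split_ifs <;> simp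
  · split_ifs <;> simp

theorem degreeBefore_requests (G : Instance) (s : Fin G.servers) :
    G.degreeBefore G.requests s = G.serverDegree s := by
  simp [Instance.degreeBefore, Instance.serverDegree]

/-! ### One round of the OCS-based algorithm -/

theorem pmfMean_ocsLaw_succ {f : ℕ → ℝ} (hf : ∀ l, 0 < f l) (G : Instance) {i : ℕ}
    (hi : i < G.requests) (φ : Finset (Fin G.servers) → ℝ) :
    pmfMean (ocsLaw f hf G (i + 1)) φ = pmfMean (ocsLaw f hf G i) fun M =>
      if (G.nbrs ⟨i, hi⟩ \ M).Nonempty then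
        (∑ s ∈ G.nbrs ⟨i, hi⟩ \ M, f (G.degreeBefore i s) * φ (insert s M)) /
          ∑ s ∈ G.nbrs ⟨i, hi⟩ \ M, f (G.degreeBefore i s)
      else φ M := by
  rw [ocsLaw, dif_pos hi, pmfMean_bind]
  congr 1
  funext M
  split_ifs with hA
  · rw [pmfMean_map, pmfMean_weightedChoice]
  · rw [pmfMean_pure]

/-- The inequality that makes the induction for the OCS-based algorithm work. -/
theorem prod_ratio_le {m : ℕ} {d : ℕ} {f : ℕ → ℝ} (hf : ∀ l, 0 < f l)
    (hcand : ∀ l j : ℕ, 1 ≤ j → j < d →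
      f (l + 1) ≤ f l * (1 + (j : ℝ) * f l / ((d : ℝ) - (j : ℝ))) ^ ((1 : ℝ) / (j : ℝ)))
    (T : Finset (Fin m)) (hT : T.card < d) (l : Fin m → ℕ) :
    ∏ s ∈ T, f (l s + 1) / f (l s) ≤ 1 + (∑ s ∈ T, f (l s)) / ((d : ℝ) - T.card) := by
  rcases T.eq_empty_or_nonempty with rfl | hne
  · simp
  have hc : 0 < T.card := hne.card_pos
  have hcR : (0 : ℝ) < T.card := by exact_mod_cast hc
  have hx : (0 : ℝ) < d - T.card := sub_pos.2 (by exact_mod_cast hT)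
  have hnn : ∀ s, 0 ≤ 1 + (T.card : ℝ) * f (l s) / ((d : ℝ) - T.card) := fun s => by
    have := hf (l s)
    positivity
  calc ∏ s ∈ T, f (l s + 1) / f (l s)
      ≤ ∏ s ∈ T, (1 + (T.card : ℝ) * f (l s) / ((d : ℝ) - T.card)) ^ ((1 : ℝ) / (T.card : ℝ)) := by
        refine Finset.prod_le_prod (fun s _ => (div_pos (hf _) (hf _)).le) fun s _ => ?_
        rw [div_le_iff₀' (hf _)]
        exact hcand (l s) T.card hc hT
    -- AM-GM with equal weights: the `m`-th roots in the recursion, with `m = T.card`, turn the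
    -- product into a geometric mean.
    _ ≤ ∑ s ∈ T, (1 : ℝ) / (T.card : ℝ) * (1 + (T.card : ℝ) * f (l s) / ((d : ℝ) - T.card)) := by
        refine Real.geom_mean_le_arith_mean_weighted T _ _ (fun _ _ => by positivity) ?_
          fun s _ => hnn s
        rw [Finset.sum_const, nsmul_eq_mul]
        field_simp
    _ = _ := by
        rw [← Finset.mul_sum, Finset.sum_add_distrib, Finset.sum_const, nsmul_eq_mul,
          ← Finset.sum_div, ← Finset.mul_sum]
        field_simp

/-- While `U` is unmatched, it survives the round with probability `X / (a + X)`, where `X` is the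
random weight of the available neighbours outside `U`. The right side is the mean of the tangent at
`X = x`, namely `(x² + a X) / (a + x)²`; being linear in `X`, it involves only the sets `insert t
U`. -/
theorem pmfMean_avoids_succ_le {f : ℕ → ℝ} (hf : ∀ l, 0 < f l) (G : Instance) {i : ℕ}
    (hi : i < G.requests) (U : Finset (Fin G.servers)) {x : ℝ} (hx : 0 < x) :
    pmfMean (ocsLaw f hf G (i + 1)) (avoids U) ≤
      (x ^ 2 * pmfMean (ocsLaw f hf G i) (avoids U) +
        (∑ s ∈ G.nbrs ⟨i, hi⟩ ∩ U, f (G.degreeBefore i s)) * ∑ t ∈ G.nbrs ⟨i, hi⟩ \ U,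
          f (G.degreeBefore i t) * pmfMean (ocsLaw f hf G i) (avoids (insert t U))) /
      ((∑ s ∈ G.nbrs ⟨i, hi⟩ ∩ U, f (G.degreeBefore i s)) + x) ^ 2 := by
  set N := G.nbrs ⟨i, hi⟩ with hN
  set w : Fin G.servers → ℝ := fun s => f (G.degreeBefore i s) with hw
  have hwpos : ∀ s, 0 < w s := fun s => hf _
  set a := ∑ s ∈ N ∩ U, w s with ha
  have ha0 : 0 ≤ a := Finset.sum_nonneg fun s _ => (hwpos s).le
  rw [pmfMean_ocsLaw_succ hf G hi]
  have hR : (x ^ 2 * pmfMean (ocsLaw f hf G i) (avoids U) +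
        a * ∑ t ∈ N \ U, w t * pmfMean (ocsLaw f hf G i) (avoids (insert t U))) / (a + x) ^ 2 =
      pmfMean (ocsLaw f hf G i) fun M => ((a + x) ^ 2)⁻¹ * (x ^ 2 * avoids U M +
        a * ∑ t ∈ N \ U, w t * avoids (insert t U) M) := by
    rw [pmfMean_const_mul, pmfMean_add, pmfMean_const_mul, pmfMean_const_mul, pmfMean_sum]
    simp only [pmfMean_const_mul]
    rw [div_eq_inv_mul]
  refine le_trans ?_ hR.ge
  refine pmfMean_mono _ fun M => ?_
  have hax : 0 < (a + x) ^ 2 := by positivity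
  by_cases hd : Disjoint U M
  · have hav : avoids U M = 1 := if_pos hd
    set X := ∑ t ∈ (N \ M) \ U, w t with hX
    have hX0 : 0 ≤ X := Finset.sum_nonneg fun s _ => (hwpos s).le
    have e1 : ∑ t ∈ N \ U, w t * avoids (insert t U) M = X := by
      rw [hX, sdiff_right_comm, Finset.sdiff_eq_filter (N \ U) M, Finset.sum_filter]
      refine Finset.sum_congr rfl fun t _ => ?_
      rw [avoids_insert_left, hav]
      split_ifs <;> simp_all
    have e2 : ∑ s ∈ N \ M, w s * avoids U (insert s M) = X := by
      rw [hX, Finset.sdiff_eq_filter (N \ M) U, Finset.sum_filter]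
      refine Finset.sum_congr rfl fun t _ => ?_
      rw [avoids_insert_right, hav]
      split_ifs <;> simp_all
    have e3 : ∑ s ∈ N \ M, w s = a + X := by
      rw [ha, hX, ← Finset.sum_inter_add_sum_sdiff (N \ M) U]
      congr 2
      ext s
      simp only [Finset.mem_inter, Finset.mem_sdiff]
      constructor
      · tauto
      · exact fun h => ⟨⟨h.1, fun hM => Finset.disjoint_left.1 hd h.2 hM⟩, h.2⟩
    rw [e1, e2, e3, hav]
    rw [inv_mul_eq_div, mul_one, le_div_iff₀ hax]
    split_ifs with hA
    · have hpos : 0 < a + X := by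
        rw [← e3]; exact Finset.sum_pos (fun s _ => hwpos s) hA
      rw [div_mul_eq_mul_div, div_le_iff₀ hpos]
      -- After clearing denominators, tangent minus function is `a (x - X)²`.
      nlinarith [mul_nonneg ha0 (sq_nonneg (x - X))]
    · rw [Finset.not_nonempty_iff_eq_empty] at hA
      rw [hA, Finset.sum_empty] at e3
      have : a = 0 := by linarith
      rw [this]; nlinarith
  · have hav : avoids U M = 0 := if_neg hd
    have e : ∀ s, avoids U (insert s M) = 0 := fun s => by rw [avoids_insert_right, hav, zero_mul]
    simp only [e, mul_zero, Finset.sum_const_zero, zero_div, hav, ite_self, zero_add]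
    exact mul_nonneg (inv_nonneg.2 hax.le) (mul_nonneg ha0 (Finset.sum_nonneg fun t _ =>
      mul_nonneg (hwpos t).le (avoids_nonneg _ _)))

/-- A request all of whose neighbours lie in `U` is matched inside `U`, unless `U` was hit before.
-/
theorem pmfMean_avoids_succ_of_subset {f : ℕ → ℝ} (hf : ∀ l, 0 < f l) (G : Instance) {i : ℕ}
    (hi : i < G.requests) (U : Finset (Fin G.servers)) (hne : (G.nbrs ⟨i, hi⟩).Nonempty)
    (hU : G.nbrs ⟨i, hi⟩ ⊆ U) :
    pmfMean (ocsLaw f hf G (i + 1)) (avoids U) ≤ 0 := by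
  rw [pmfMean_ocsLaw_succ hf G hi, ← pmfMean_const (ocsLaw f hf G i) 0]
  refine pmfMean_mono _ fun M => ?_
  split_ifs with hA
  · rw [Finset.sum_eq_zero, zero_div]
    intro s hs
    rw [avoids_insert_right, if_pos (hU (Finset.mem_sdiff.1 hs).1)]
    ring
  · rw [avoids, if_neg]
    intro hd
    obtain ⟨s, hs⟩ := hne
    exact hA ⟨s, Finset.mem_sdiff.2 ⟨hs, Finset.disjoint_left.1 hd (hU hs)⟩⟩

/-- The OCS-based algorithm leaves all servers of `U` unmatched with probability at most
`∏ s ∈ U, 1 / f (l s)`. -/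
theorem pmfMean_avoids_le {d : ℕ} (hd : 1 ≤ d) {f : ℕ → ℝ} (hf : ∀ l, 0 < f l) (hf0 : f 0 = 1)
    (hcand : ∀ l j : ℕ, 1 ≤ j → j < d →
      f (l + 1) ≤ f l * (1 + (j : ℝ) * f l / ((d : ℝ) - (j : ℝ))) ^ ((1 : ℝ) / (j : ℝ)))
    (G : Instance) (hG : ∀ r, (G.nbrs r).card ≤ d) {i : ℕ} (hi : i ≤ G.requests)
    (U : Finset (Fin G.servers)) :
    pmfMean (ocsLaw f hf G i) (avoids U) ≤ ∏ s ∈ U, (f (G.degreeBefore i s))⁻¹ := by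
  induction i generalizing U with
  | zero =>
    rw [ocsLaw, pmfMean_pure]
    simp [degreeBefore_zero, hf0, avoids]
  | succ i ih =>
    have hi' : i < G.requests := hi
    replace ih := ih hi'.le
    set N := G.nbrs ⟨i, hi'⟩ with hN
    have hprodpos : ∀ (j : ℕ) (V : Finset (Fin G.servers)),
        0 < ∏ s ∈ V, (f (G.degreeBefore j s))⁻¹ := fun j V =>
      Finset.prod_pos fun s _ => inv_pos.2 (hf _)
    by_cases hm : (N ∩ U).card < d
    · have hx : (0 : ℝ) < d - (N ∩ U).card := sub_pos.2 (by exact_mod_cast hm)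
      refine (pmfMean_avoids_succ_le hf G hi' U hx).trans ?_
      rw [← hN]
      set x : ℝ := d - (N ∩ U).card with hxdef
      set a := ∑ s ∈ N ∩ U, f (G.degreeBefore i s) with ha
      have ha0 : 0 ≤ a := Finset.sum_nonneg fun s _ => (hf _).le
      set P := ∏ s ∈ U, (f (G.degreeBefore i s))⁻¹ with hP
      have hP0 : 0 < P := hprodpos i U
      -- The weight of `t` cancels the factor that `t` contributes to the bound for `insert t U`, so
      -- each of the at most `d - m` terms is at most `P`. This is why the tangent is taken at `x =
      -- d - m`.
      have h1 : ∑ t ∈ N \ U, f (G.degreeBefore i t) *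
          pmfMean (ocsLaw f hf G i) (avoids (insert t U)) ≤ x * P := by
        calc _ ≤ ∑ t ∈ N \ U, P := by
              refine Finset.sum_le_sum fun t ht => ?_
              have := ih (insert t U)
              rw [Finset.prod_insert (Finset.mem_sdiff.1 ht).2] at this
              calc _ ≤ f (G.degreeBefore i t) * ((f (G.degreeBefore i t))⁻¹ * P) :=
                    mul_le_mul_of_nonneg_left this (hf _).le
                _ = P := by rw [← mul_assoc, mul_inv_cancel₀ (hf _).ne', one_mul]
          _ ≤ x * P := by
              rw [Finset.sum_const, nsmul_eq_mul]
              refine mul_le_mul_of_nonneg_right ?_ hP0.le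
              have h2 := Finset.card_sdiff_add_card_inter N U
              have h3 : ((N \ U).card : ℝ) + (N ∩ U).card ≤ d := by
                exact_mod_cast h2.le.trans (hG _)
              rw [hxdef]; linarith
      have h2 : P / (1 + a / x) ≤ ∏ s ∈ U, (f (G.degreeBefore (i + 1) s))⁻¹ := by
        have hstep : ∀ s, (f (G.degreeBefore (i + 1) s))⁻¹ = (f (G.degreeBefore i s))⁻¹ *
            (if s ∈ N then f (G.degreeBefore i s + 1) / f (G.degreeBefore i s) else 1)⁻¹ := by
          intro s
          rw [degreeBefore_succ G hi']
          split_ifs with h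
          · have := (hf (G.degreeBefore i s)).ne'
            rw [inv_div, inv_mul_eq_div, div_div, mul_comm, ← div_div, div_self this, one_div]
          · simp
        rw [Finset.prod_congr rfl fun s _ => hstep s, Finset.prod_mul_distrib,
          ← hP, Finset.prod_inv_distrib, ← Finset.prod_filter, Finset.filter_mem_eq_inter,
          Finset.inter_comm U N, div_eq_mul_inv]
        refine mul_le_mul_of_nonneg_left (inv_anti₀ ?_ ?_) hP0.le
        · exact Finset.prod_pos fun s _ => div_pos (hf _) (hf _)
        · exact prod_ratio_le hf hcand _ hm _
      refine le_trans ?_ h2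
      have h3 := ih U
      rw [div_le_div_iff₀ (by positivity) (by positivity)]
      have h4 : x ^ 2 * pmfMean (ocsLaw f hf G i) (avoids U) + a * ∑ t ∈ N \ U,
          f (G.degreeBefore i t) * pmfMean (ocsLaw f hf G i) (avoids (insert t U)) ≤
          x ^ 2 * P + a * (x * P) := by gcongr
      calc _ ≤ (x ^ 2 * P + a * (x * P)) * (1 + a / x) := by gcongr
        _ = P * (a + x) ^ 2 := by field_simp; ring
    · push Not at hm
      have hsub : N ⊆ U := by
        have : N ∩ U = N := Finset.eq_of_subset_of_card_le Finset.inter_subset_left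
          ((hG _).trans hm)
        exact Finset.inter_eq_left.1 this
      have hne : N.Nonempty := Finset.card_pos.1
        (by have := Finset.card_le_card (Finset.inter_subset_left (s₁ := N) (s₂ := U)); omega)
      exact (pmfMean_avoids_succ_of_subset hf G hi' U hne hsub).trans (hprodpos _ _).le

theorem le_ocsValue {k d : ℕ} (hd : 2 ≤ d) {G : Instance} (hG : G.IsBounded k d) :
    (G.servers : ℝ) * (1 - (optimalCandidate d k)⁻¹) ≤
      ocsValue (optimalCandidate d) (optimalCandidate_pos d) G := by
  set f := optimalCandidate d
  set hf := optimalCandidate_pos d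
  have hcard : ∀ M : Finset (Fin G.servers),
      (M.card : ℝ) = ∑ s : Fin G.servers, (1 - avoids {s} M) := by
    intro M
    have : ∀ s, 1 - avoids {s} M = if s ∈ M then 1 else 0 := by
      intro s
      simp only [avoids, Finset.disjoint_singleton_left]
      split_ifs <;> simp_all
    simp [this]
  have h1 : ocsValue f hf G = pmfMean (ocsLaw f hf G G.requests) fun M =>
      ∑ s : Fin G.servers, (1 - avoids {s} M) := by
    rw [ocsValue, pmfMean]
    exact Finset.sum_congr rfl fun M _ => by rw [hcard M]
  rw [h1, pmfMean_sum]
  simp only [pmfMean_sub, pmfMean_const]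
  calc (G.servers : ℝ) * (1 - (f k)⁻¹) = ∑ _s : Fin G.servers, (1 - (f k)⁻¹) := by simp; ring
    _ ≤ _ := by
      refine Finset.sum_le_sum fun s _ => ?_
      have h2 := pmfMean_avoids_le (by omega : 1 ≤ d) hf rfl
        (fun l j hj hjd => optimalCandidate_succ_le hj hjd l) G hG.2 le_rfl {s}
      rw [Finset.prod_singleton, degreeBefore_requests] at h2
      have h3 : (f (G.serverDegree s))⁻¹ ≤ (f k)⁻¹ :=
        inv_anti₀ (hf k) (optimalCandidate_monotone hd (hG.1 s))
      change 1 - (f k)⁻¹ ≤ 1 - pmfMean (ocsLaw f hf G G.requests) (avoids {s})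
      linarith

/-! ### Maximum matchings -/

theorem opt_le_servers (G : Instance) : G.opt ≤ G.servers := by
  classical
  refine Finset.sup_le fun M hM => ?_
  have hM := (Finset.mem_filter.1 hM).2
  have := Finset.card_le_card_of_injOn (s := M) (t := Finset.univ) Prod.snd
    (fun _ _ => Finset.mem_coe.2 (Finset.mem_univ _))
    (fun e he e' he' h => hM.2 e he e' he' (Or.inr h))
  simpa using this

theorem card_le_opt {G : Instance} {M : Finset (Fin G.requests × Fin G.servers)}
    (hM : G.IsMatching M) : M.card ≤ G.opt := by
  classical
  exact Finset.le_sup (f := Finset.card) (Finset.mem_filter.2 ⟨Finset.mem_univ _, hM⟩)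

theorem servers_le_opt {G : Instance} (g : Fin G.servers → Fin G.requests)
    (hg : Function.Injective g) (hgn : ∀ s, s ∈ G.nbrs (g s)) : G.servers ≤ G.opt := by
  classical
  have hM : G.IsMatching (Finset.univ.image fun s => (g s, s)) := by
    constructor
    · intro e he
      obtain ⟨s, _, rfl⟩ := Finset.mem_image.1 he
      exact hgn s
    · intro e he e' he' h
      obtain ⟨s, _, rfl⟩ := Finset.mem_image.1 he
      obtain ⟨s', _, rfl⟩ := Finset.mem_image.1 he'
      have : s = s' := h.elim (fun h => hg h) id
      rw [this]
  have := card_le_opt hM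
  rwa [Finset.card_image_of_injective _ fun s s' h => (Prod.mk.inj h).2, Finset.card_univ,
    Fintype.card_fin] at this

/-- An admissible instance must exist, since the real infimum of the empty set is 0. -/
theorem le_ocsRatio {k d : ℕ} (hd : 2 ≤ d)
    (hex : ∃ G : Instance, G.IsBounded k d ∧ 0 < G.opt) :
    1 - (optimalCandidate d k)⁻¹ ≤ ocsRatio k d := by
  obtain ⟨G₀, hG₀, hopt₀⟩ := hex
  refine le_csInf ⟨_, G₀, hG₀, hopt₀, rfl⟩ ?_
  rintro x ⟨G, hG, hopt, rfl⟩
  have hopt' : (0 : ℝ) < G.opt := by exact_mod_cast hopt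
  rw [le_div_iff₀ hopt']
  have h1 : 0 ≤ 1 - (optimalCandidate d k)⁻¹ := by
    have : (1 : ℝ) ≤ optimalCandidate d k := by
      have := optimalCandidate_monotone hd (Nat.zero_le k)
      simpa [optimalCandidate] using this
    have := inv_le_one_of_one_le₀ this
    linarith
  have h2 : (G.opt : ℝ) ≤ G.servers := by exact_mod_cast opt_le_servers G
  calc _ ≤ (1 - (optimalCandidate d k)⁻¹) * G.servers := by gcongr
    _ = G.servers * (1 - (optimalCandidate d k)⁻¹) := mul_comm _ _
    _ ≤ _ := le_ocsValue hd hG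

/-! ### Slicing product measures -/

theorem measurable_update_prod {ι : Type*} [DecidableEq ι] (t : ι) :
    Measurable fun p : (ι → ℝ) × ℝ => Function.update p.1 t p.2 := by
  refine measurable_pi_iff.2 fun i => ?_
  by_cases h : i = t
  · subst h; simpa using measurable_snd
  · simpa [Function.update_of_ne h, Function.comp_def] using
      (measurable_pi_apply i).comp measurable_fst

/-- Resampling one coordinate independently does not change the product law. With Fubini this lets
one rank at a time be conditioned on. -/
theorem map_update_prod {ι : Type*} [Fintype ι] [DecidableEq ι] (ν : Measure ℝ)
    [IsProbabilityMeasure ν] (t : ι) :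
    ((Measure.pi fun _ : ι => ν).prod ν).map (fun p => Function.update p.1 t p.2) =
      Measure.pi fun _ : ι => ν := by
  have hm := measurable_update_prod t
  refine (Measure.pi_eq fun s hs => ?_).symm
  rw [Measure.map_apply hm (MeasurableSet.univ_pi hs)]
  have : (fun p : (ι → ℝ) × ℝ => Function.update p.1 t p.2) ⁻¹' Set.univ.pi s =
      (Set.univ.pi (Function.update s t Set.univ)) ×ˢ s t := by
    ext ⟨y, w⟩
    simp only [Set.mem_preimage, Set.mem_univ_pi, Set.mem_prod]
    constructor
    · intro h
      refine ⟨fun i => ?_, by simpa using h t⟩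
      by_cases hi : i = t
      · subst hi; simp
      · simpa [Function.update_of_ne hi] using h i
    · rintro ⟨h1, h2⟩ i
      by_cases hi : i = t
      · subst hi; simpa using h2
      · simpa [Function.update_of_ne hi] using h1 i
  rw [this, Measure.prod_prod, Measure.pi_pi, ← Finset.prod_erase_mul _ _ (Finset.mem_univ t),
    ← Finset.prod_erase_mul _ (fun i => ν (s i)) (Finset.mem_univ t)]
  simp only [Function.update_self, measure_univ, mul_one]
  congr 1
  refine Finset.prod_congr rfl fun i hi => ?_
  rw [Function.update_of_ne (Finset.ne_of_mem_erase hi)]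

theorem pi_apply_eq_lintegral_update {ι : Type*} [Fintype ι] [DecidableEq ι] (ν : Measure ℝ)
    [IsProbabilityMeasure ν] (t : ι) {S : Set (ι → ℝ)} (hS : MeasurableSet S) :
    (Measure.pi fun _ : ι => ν) S =
      ∫⁻ w, (Measure.pi fun _ : ι => ν) {y | Function.update y t w ∈ S} ∂ν := by
  have hm := measurable_update_prod t
  conv_lhs => rw [← map_update_prod ν t]
  rw [Measure.map_apply hm hS, Measure.prod_apply_symm (hm hS)]
  rfl

/-! ### The survival of an old server -/

/-- The requests that reveal `P ∪ {f}` for `f` running through a list of fresh servers leave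
`s ∈ P` unmatched. -/
def survives {ι : Type*} [DecidableEq ι] (s : ι) : List ι → Finset ι → (ι → ℝ) → Prop
  | [], P, _ => s ∈ P
  | f :: L, P, y => ((∀ u ∈ P, y f < y u) ∧ survives s L P y) ∨
      ∃ t ∈ P, t ≠ s ∧ (∀ u ∈ P.erase t, y t < y u) ∧ y t < y f ∧ survives s L (P.erase t) y

theorem measurableSet_forall_lt {ι : Type*} (P : Finset ι) (g : (ι → ℝ) → ℝ) (hg : Measurable g) :
    MeasurableSet {y : ι → ℝ | ∀ u ∈ P, g y < y u} := by
  have : {y : ι → ℝ | ∀ u ∈ P, g y < y u} = ⋂ u ∈ P, {y | g y < y u} := by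
    ext; simp
  rw [this]
  exact Finset.measurableSet_biInter P fun u _ => measurableSet_lt hg (measurable_pi_apply u)

section survives

variable {ι : Type*} [DecidableEq ι]

theorem measurableSet_survives (s : ι) (L : List ι) (P : Finset ι) :
    MeasurableSet {y | survives s L P y} := by
  induction L generalizing P with
  | nil => simp [survives]
  | cons f L ih =>
    have : {y : ι → ℝ | survives s (f :: L) P y} =
        ({y | ∀ u ∈ P, y f < y u} ∩ {y | survives s L P y}) ∪
        ⋃ t ∈ P.erase s, ({y | ∀ u ∈ P.erase t, y t < y u} ∩
          ({y | y t < y f} ∩ {y | survives s L (P.erase t) y})) := by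
      ext y
      simp only [survives, Set.mem_ofPred_eq, Set.mem_union, Set.mem_iUnion, Set.mem_inter_iff,
        Finset.mem_erase (s := P) (b := s), exists_prop]
      refine or_congr Iff.rfl (exists_congr fun t => ?_)
      tauto
    rw [this]
    refine ((measurableSet_forall_lt P _ (measurable_pi_apply f)).inter (ih P)).union ?_
    exact Finset.measurableSet_biUnion _ fun t _ =>
      (measurableSet_forall_lt _ _ (measurable_pi_apply t)).inter
        ((measurableSet_lt (measurable_pi_apply t) (measurable_pi_apply f)).inter (ih _))

/-- Survival depends only on the ranks of servers in `L` and `P`. Hence a rank that has played its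
part may be integrated out. -/
theorem survives_update (s : ι) {L : List ι} {P : Finset ι} {i : ι} (hL : i ∉ L) (hP : i ∉ P)
    (y : ι → ℝ) (w : ℝ) : survives s L P (Function.update y i w) ↔ survives s L P y := by
  induction L generalizing P with
  | nil => rfl
  | cons f L ih =>
    simp only [List.mem_cons, not_or] at hL
    have hne : ∀ u ∈ P, Function.update y i w u = y u := fun u hu =>
      Function.update_of_ne (fun h : u = i => hP (h ▸ hu)) _ _
    have hf : Function.update y i w f = y f := Function.update_of_ne (Ne.symm hL.1) _ _
    simp only [survives, hf, ih hL.2 hP]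
    refine or_congr (and_congr (forall₂_congr fun u hu => by rw [hne u hu]) Iff.rfl) ?_
    refine exists_congr fun t => and_congr_right fun ht => and_congr_right fun _ => ?_
    rw [hne t ht, ih hL.2 fun h => hP (Finset.mem_of_mem_erase h)]
    refine and_congr (forall₂_congr fun u hu => by rw [hne u (Finset.mem_of_mem_erase hu)]) Iff.rfl

end survives

/-- The uniform distribution of a rank. -/
abbrev rankMeasure : Measure ℝ := volume.restrict (Set.Icc (0 : ℝ) 1)

instance : IsProbabilityMeasure rankMeasure := ⟨by simp [rankMeasure]⟩

theorem lintegral_rankMeasure {θ : ℝ} (h0 : 0 ≤ θ) (h1 : θ ≤ 1) (F : ℝ → ENNReal) :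
    ∫⁻ w, F w ∂rankMeasure = (∫⁻ w in Set.Icc 0 θ, F w) + ∫⁻ w in Set.Ioc θ 1, F w := by
  rw [rankMeasure, ← Set.Icc_union_Ioc_eq_Icc h0 h1, lintegral_union measurableSet_Ioc]
  rw [Set.disjoint_left]
  exact fun x hx hx' => absurd hx.2 (not_le.2 hx'.1)

theorem setLIntegral_Ioc_ofReal {g : ℝ → ℝ} (hg : Continuous g) {θ : ℝ} (h1 : θ ≤ 1)
    (hg0 : ∀ w ∈ Set.Ioc θ 1, 0 ≤ g w) :
    ∫⁻ w in Set.Ioc θ 1, ENNReal.ofReal (g w) = ENNReal.ofReal (∫ w in θ..1, g w) := by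
  rw [intervalIntegral.integral_of_le h1, ofReal_integral_eq_lintegral_ofReal]
  · exact (hg.integrableOn_Icc).mono_set Set.Ioc_subset_Icc_self
  · exact (ae_restrict_iff' measurableSet_Ioc).2 (Filter.Eventually.of_forall hg0)

theorem rankMeasure_Ioi {w : ℝ} (h0 : 0 ≤ w) : rankMeasure (Set.Ioi w) = ENNReal.ofReal (1 - w) := by
  rw [rankMeasure, Measure.restrict_apply measurableSet_Ioi]
  have : Set.Ioi w ∩ Set.Icc 0 1 = Set.Ioc w 1 := by
    ext x
    simp only [Set.mem_inter_iff, Set.mem_Ioi, Set.mem_Icc, Set.mem_Ioc]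
    exact ⟨fun h => ⟨h.1, h.2.2⟩, fun h => ⟨h.1, h0.trans h.1.le, h.2⟩⟩
  rw [this, Real.volume_Ioc]

/-- The lower bound for the probability that `s` survives `i` requests from a state with `c` old
servers, on the event that the ranks of these exceed `1 - a`. -/
def survivalBound (c i : ℕ) (a : ℝ) : ℝ := a ^ c * (1 - a / ((c : ℝ) + 1)) ^ i

theorem survivalBound_nonneg (c i : ℕ) {a : ℝ} (h0 : 0 ≤ a) (h1 : a ≤ 1) :
    0 ≤ survivalBound c i a := by
  have : a / ((c : ℝ) + 1) ≤ 1 := by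
    rw [div_le_one (by positivity)]
    have : (0 : ℝ) ≤ c := Nat.cast_nonneg c
    linarith
  exact mul_nonneg (pow_nonneg h0 _) (pow_nonneg (by linarith) _)

theorem continuous_survivalBound (c i : ℕ) : Continuous (survivalBound c i) := by
  unfold survivalBound
  fun_prop

theorem pow_tangent_le {u v : ℝ} (hu : 0 ≤ u) (hv : 0 ≤ v) (i : ℕ) :
    v ^ i + i * v ^ (i - 1) * (u - v) ≤ u ^ i := by
  induction i with
  | zero => simp
  | succ i ih =>
    rcases Nat.eq_zero_or_pos i with rfl | hi
    · simp
    obtain ⟨i, rfl⟩ := Nat.exists_eq_succ_of_ne_zero hi.ne'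
    simp only [Nat.succ_eq_add_one, Nat.add_sub_cancel] at ih ⊢
    have h1 := mul_le_mul_of_nonneg_right ih hu
    have h2 : 0 ≤ ((i : ℝ) + 1) * v ^ i * (u - v) ^ 2 := by positivity
    push_cast at h1 ⊢
    calc _ = (v ^ (i + 1) + (↑i + 1) * v ^ i * (u - v)) * u -
          ((i : ℝ) + 1) * v ^ i * (u - v) ^ 2 := by ring
      _ ≤ _ := by rw [pow_succ u (i + 1)]; linarith

/-- The three terms on the right are the cases of one request: the fresh rank is at most `θ`; it is
`w > θ` and below all old ranks; or one of the `n` old servers other than `s` has the smallest rank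
`w` and is taken, the fresh rank exceeding `w` with probability `1 - w`. -/
theorem survivalBound_succ_le (n i : ℕ) {θ : ℝ} (h0 : 0 ≤ θ) (h1 : θ ≤ 1) :
    survivalBound (n + 1) (i + 1) (1 - θ) ≤ θ * survivalBound (n + 1) i (1 - θ) +
      (∫ w in θ..1, survivalBound (n + 1) i (1 - w)) +
      n * ∫ w in θ..1, (1 - w) * survivalBound n i (1 - w) := by
  set D : ℝ := (n : ℝ) + 2 with hD
  have hD0 : 0 < D := by positivity
  have hDc : ((n + 1 : ℕ) : ℝ) + 1 = D := by push_cast; rw [hD]; ring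
  -- `H` vanishes at 1, and `-H θ` is exactly the left side minus the first term on the right. It is
  -- therefore enough to compare `H'` with the integrands pointwise.
  set H : ℝ → ℝ := fun w => -((D - 1) / D * ((1 - w) ^ (n + 2) * (1 - (1 - w) / D) ^ i)) with hH
  set H' : ℝ → ℝ := fun w => (D - 1) * ((1 - w) ^ (n + 1) * (1 - (1 - w) / D) ^ i) -
    (D - 1) / D * ((1 - w) ^ (n + 2) * (i * (1 - (1 - w) / D) ^ (i - 1) * D⁻¹)) with hH'
  have hderiv : ∀ w, HasDerivAt H (H' w) w := by
    intro w
    have e1 : HasDerivAt (fun w : ℝ => 1 - w) (-1) w := by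
      simpa using (hasDerivAt_id w).const_sub 1
    have e2 : HasDerivAt (fun w : ℝ => 1 - (1 - w) / D) D⁻¹ w := by
      refine ((e1.div_const D).const_sub 1).congr_deriv ?_
      rw [neg_div, neg_neg, one_div]
    have := ((((e1.pow (n + 2)).mul (e2.pow i)).const_mul ((D - 1) / D)).neg)
    refine this.congr_deriv ?_
    simp only [hH', Pi.pow_apply]
    have e3 : n + 2 - 1 = n + 1 := by omega
    rw [e3]
    push_cast
    rw [← hD]
    field_simp
    ring
  have hH'c : Continuous H' := by simp only [hH']; fun_prop
  have hint : ∫ w in θ..1, H' w = (D - 1) / D * ((1 - θ) ^ (n + 2) * (1 - (1 - θ) / D) ^ i) := by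
    rw [intervalIntegral.integral_eq_sub_of_hasDerivAt (fun w _ => hderiv w)
      (hH'c.intervalIntegrable _ _)]
    simp [hH]
  have hc1 : Continuous fun w : ℝ => survivalBound (n + 1) i (1 - w) :=
    (continuous_survivalBound _ _).comp (by fun_prop)
  have hc2 : Continuous fun w : ℝ => (1 - w) * survivalBound n i (1 - w) :=
    (by fun_prop : Continuous fun w : ℝ => 1 - w).mul
      ((continuous_survivalBound _ _).comp (by fun_prop))
  have hle : ∫ w in θ..1, H' w ≤ (∫ w in θ..1, survivalBound (n + 1) i (1 - w)) +
      n * ∫ w in θ..1, (1 - w) * survivalBound n i (1 - w) := by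
    rw [← intervalIntegral.integral_const_mul, ← intervalIntegral.integral_add
      (hc1.intervalIntegrable _ _) ((hc2.const_mul (n : ℝ)).intervalIntegrable _ _)]
    refine intervalIntegral.integral_mono_on h1 (hH'c.intervalIntegrable _ _)
      ((hc1.add (hc2.const_mul (n : ℝ))).intervalIntegrable _ _) fun w hw => ?_
    have hx0 : 0 ≤ 1 - w := by linarith [hw.2]
    have hx1 : 1 - w ≤ 1 := by linarith [hw.1]
    set x := 1 - w with hx
    have hn0 : (0 : ℝ) ≤ n := Nat.cast_nonneg n
    have hv : 0 ≤ 1 - x / D := by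
      rw [sub_nonneg, div_le_one hD0]; linarith
    have hu : 0 ≤ 1 - x / ((n : ℝ) + 1) := by
      rw [sub_nonneg, div_le_one (by positivity)]; linarith
    -- The `i`-th power belonging to `n` old servers is estimated by its tangent at the base
    -- belonging to `n + 1`, so that all terms share the same powers.
    have ht := pow_tangent_le hu hv i
    have hsb : survivalBound (n + 1) i x = x ^ (n + 1) * (1 - x / D) ^ i := by
      rw [survivalBound, hDc]
    have hsb' : x * survivalBound n i x = x ^ (n + 1) * (1 - x / ((n : ℝ) + 1)) ^ i := by
      rw [survivalBound]; ring
    rw [hsb, hsb']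
    simp only [hH', ← hx]
    set V := (1 - x / D) ^ i with hV
    set W := (1 - x / D) ^ (i - 1) with hW
    have hW0 : 0 ≤ W := pow_nonneg hv _
    have hdiff : 1 - x / ((n : ℝ) + 1) - (1 - x / D) = -(x / (((n : ℝ) + 1) * D)) := by
      rw [hD]; field_simp; ring
    rw [hdiff] at ht
    have h3 : (n : ℝ) * (V + i * W * -(x / (((n : ℝ) + 1) * D))) ≤
        n * (1 - x / ((n : ℝ) + 1)) ^ i := mul_le_mul_of_nonneg_left ht hn0
    -- After clearing denominators, this is `n (n + 2) ≤ (n + 1)²`.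
    have h4 : (n : ℝ) * (x / (((n : ℝ) + 1) * D)) ≤ (D - 1) / D * (x * D⁻¹) := by
      have e : (D - 1) / D * (x * D⁻¹) - (n : ℝ) * (x / (((n : ℝ) + 1) * D)) =
          x / (((n : ℝ) + 1) * D ^ 2) := by
        rw [hD]; field_simp; ring
      have : 0 ≤ x / (((n : ℝ) + 1) * D ^ 2) := by positivity
      linarith
    have h5 : (D - 1) * V - (D - 1) / D * (x * (i * W * D⁻¹)) ≤
        V + n * (1 - x / ((n : ℝ) + 1)) ^ i := by
      have h6 := mul_le_mul_of_nonneg_left h4 (mul_nonneg (Nat.cast_nonneg i : (0 : ℝ) ≤ i) hW0)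
      have hDn : D - 1 = n + 1 := by rw [hD]; ring
      have h7 : (D - 1) * V = n * V + V := by rw [hDn]; ring
      rw [h7]
      linarith
    have h6 := mul_le_mul_of_nonneg_left h5 (pow_nonneg hx0 (n + 1))
    calc _ = x ^ (n + 1) * ((D - 1) * V - (D - 1) / D * (x * (i * W * D⁻¹))) := by ring
      _ ≤ _ := h6
      _ = _ := by ring
  have heq : survivalBound (n + 1) (i + 1) (1 - θ) = θ * survivalBound (n + 1) i (1 - θ) +
      (D - 1) / D * ((1 - θ) ^ (n + 2) * (1 - (1 - θ) / D) ^ i) := by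
    rw [survivalBound, survivalBound, hDc]
    generalize hV : (1 - (1 - θ) / D) ^ i = V
    rw [pow_succ (1 - (1 - θ) / D) i, hV]
    field_simp
    ring
  rw [heq, ← hint]
  linarith

/-- The threshold `θ` closes the induction: once the smallest rank `w` is exposed, all that is known
of the remaining old ranks is that they exceed `w`, which is the same event with threshold `w`. The
cases of the first request are disjoint, so their probabilities add up to the recursion in
`survivalBound_succ_le`. -/
theorem ofReal_survivalBound_le {ι : Type*} [Fintype ι] [DecidableEq ι] {s : ι} {L : List ι}
    {P : Finset ι} (hL : L.Nodup) (hLP : ∀ f ∈ L, f ∉ P) (hs : s ∈ P) {θ : ℝ} (h0 : 0 ≤ θ)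
    (h1 : θ ≤ 1) :
    ENNReal.ofReal (survivalBound P.card L.length (1 - θ)) ≤
      (Measure.pi fun _ : ι => rankMeasure) {y | (∀ u ∈ P, θ < y u) ∧ survives s L P y} := by
  induction L generalizing P θ with
  | nil =>
    have : {y : ι → ℝ | (∀ u ∈ P, θ < y u) ∧ survives s [] P y} =
        Set.univ.pi fun u => if u ∈ P then Set.Ioi θ else Set.univ := by
      ext y
      simp only [survives, hs, and_true, Set.mem_ofPred_eq, Set.mem_univ_pi]
      refine forall_congr' fun u => ?_
      split_ifs with h <;> simp [h]
    rw [this, Measure.pi_pi]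
    have h2 : ∀ u, rankMeasure (if u ∈ P then Set.Ioi θ else Set.univ) =
        if u ∈ P then ENNReal.ofReal (1 - θ) else 1 := fun u => by
      split_ifs
      · exact rankMeasure_Ioi h0
      · exact measure_univ
    rw [Finset.prod_congr rfl fun u _ => h2 u, ← Finset.prod_filter, Finset.filter_mem_eq_inter,
      Finset.univ_inter, Finset.prod_const, ← ENNReal.ofReal_pow (by linarith)]
    simp [survivalBound]
  | cons f L ih =>
    set μ := Measure.pi fun _ : ι => rankMeasure with hμ
    have hfL : f ∉ L := (List.nodup_cons.1 hL).1
    have hLn : L.Nodup := (List.nodup_cons.1 hL).2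
    have hfP : f ∉ P := hLP f List.mem_cons_self
    have hLP' : ∀ g ∈ L, g ∉ P := fun g hg => hLP g (List.mem_cons_of_mem _ hg)
    obtain ⟨n, hn⟩ : ∃ n, P.card = n + 1 :=
      ⟨P.card - 1, by have := Finset.card_pos.2 ⟨s, hs⟩; omega⟩
    have hne : ∀ {u v : ι} (y : ι → ℝ) (w : ℝ), u ≠ v → Function.update y v w u = y u :=
      fun y w h => Function.update_of_ne h _ _
    set A : Set (ι → ℝ) := {y | (∀ u ∈ P, θ < y u) ∧ (∀ u ∈ P, y f < y u) ∧ survives s L P y}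
      with hA
    set B : ι → Set (ι → ℝ) := fun t => {y | θ < y t ∧ (∀ u ∈ P.erase t, y t < y u) ∧ y t < y f ∧
      survives s L (P.erase t) y} with hB
    have hAm : MeasurableSet A := (measurableSet_forall_lt P _ measurable_const).inter
      ((measurableSet_forall_lt P _ (measurable_pi_apply f)).inter (measurableSet_survives s L P))
    have hBm : ∀ t, MeasurableSet (B t) := fun t =>
      (measurableSet_lt measurable_const (measurable_pi_apply t)).inter
      ((measurableSet_forall_lt _ _ (measurable_pi_apply t)).inter
        ((measurableSet_lt (measurable_pi_apply t) (measurable_pi_apply f)).inter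
          (measurableSet_survives s L _)))
    -- the fresh server has the smallest rank
    have hμA : ENNReal.ofReal (θ * survivalBound (n + 1) L.length (1 - θ)) +
        ENNReal.ofReal (∫ w in θ..1, survivalBound (n + 1) L.length (1 - w)) ≤ μ A := by
      rw [hμ, pi_apply_eq_lintegral_update rankMeasure f hAm, lintegral_rankMeasure h0 h1]
      have hset : ∀ w : ℝ, {y | Function.update y f w ∈ A} =
          {y | (∀ u ∈ P, θ < y u) ∧ (∀ u ∈ P, w < y u) ∧ survives s L P y} := by
        intro w
        ext y
        simp only [hA, Set.mem_ofPred_eq, Function.update_self, survives_update s hfL hfP]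
        have : ∀ u ∈ P, Function.update y f w u = y u := fun u hu =>
          hne y w fun h => hfP (h ▸ hu)
        exact and_congr (forall₂_congr fun u hu => by rw [this u hu])
          (and_congr (forall₂_congr fun u hu => by rw [this u hu]) Iff.rfl)
      simp only [hset]
      refine add_le_add ?_ ?_
      · have hconst : ENNReal.ofReal (θ * survivalBound (n + 1) L.length (1 - θ)) =
            ∫⁻ _ in Set.Icc 0 θ, ENNReal.ofReal (survivalBound (n + 1) L.length (1 - θ)) := by
          rw [setLIntegral_const, Real.volume_Icc, sub_zero, ENNReal.ofReal_mul h0, mul_comm]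
        rw [hconst]
        refine setLIntegral_mono' measurableSet_Icc fun w hw => ?_
        rw [← hn]
        refine (ih hLn hLP' hs h0 h1).trans (measure_mono fun y hy => ?_)
        exact ⟨hy.1, fun u hu => hw.2.trans_lt (hy.1 u hu), hy.2⟩
      · rw [← setLIntegral_Ioc_ofReal (g := fun w => survivalBound (n + 1) L.length (1 - w))
          ((continuous_survivalBound _ _).comp (by fun_prop)) h1 fun w hw =>
            survivalBound_nonneg _ _ (by linarith [hw.2]) (by linarith [hw.1])]
        refine setLIntegral_mono' measurableSet_Ioc fun w hw => ?_
        rw [← hn]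
        refine (ih hLn hLP' hs (h0.trans hw.1.le) hw.2).trans (measure_mono fun y hy => ?_)
        exact ⟨fun u hu => hw.1.trans (hy.1 u hu), hy.1, hy.2⟩
    -- the old server `t` has the smallest rank
    have hμB : ∀ t ∈ P.erase s,
        ENNReal.ofReal (∫ w in θ..1, (1 - w) * survivalBound n L.length (1 - w)) ≤ μ (B t) := by
      intro t ht
      have htP := Finset.mem_of_mem_erase ht
      have hts := Finset.ne_of_mem_erase ht
      have htf : t ≠ f := fun h => hfP (h ▸ htP)
      have htL : t ∉ L := fun h => hLP' t h htP
      have hfe : f ∉ P.erase t := fun h => hfP (Finset.mem_of_mem_erase h)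
      have hcard : (P.erase t).card = n := by rw [Finset.card_erase_of_mem htP, hn]; rfl
      rw [hμ, pi_apply_eq_lintegral_update rankMeasure t (hBm t), lintegral_rankMeasure h0 h1]
      -- Only ranks of `t` above `θ` matter, by the definition of `B t`; the other part of the
      -- integral is dropped.
      refine le_trans ?_ le_add_self
      rw [← setLIntegral_Ioc_ofReal (g := fun w => (1 - w) * survivalBound n L.length (1 - w))
          ((by fun_prop : Continuous fun w : ℝ => 1 - w).mul
            ((continuous_survivalBound _ _).comp (by fun_prop))) h1 fun w hw =>
            mul_nonneg (by linarith [hw.2]) (survivalBound_nonneg _ _ (by linarith [hw.2])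
              (by linarith [hw.1]))]
      refine setLIntegral_mono' measurableSet_Ioc fun w hw => ?_
      have hw0 : 0 ≤ w := h0.trans hw.1.le
      have hset : {y | Function.update y t w ∈ B t} =
          {y | ((∀ u ∈ P.erase t, w < y u) ∧ survives s L (P.erase t) y) ∧ w < y f} := by
        ext y
        simp only [hB, Set.mem_ofPred_eq, Function.update_self,
          survives_update s htL (Finset.notMem_erase t P), hne y w htf.symm, hw.1, true_and]
        have : ∀ u ∈ P.erase t, Function.update y t w u = y u := fun u hu =>
          hne y w (Finset.ne_of_mem_erase hu)
        rw [forall₂_congr fun u hu => by rw [this u hu]]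
        tauto
      have hSm : MeasurableSet {y : ι → ℝ | ((∀ u ∈ P.erase t, w < y u) ∧
          survives s L (P.erase t) y) ∧ w < y f} :=
        ((measurableSet_forall_lt _ _ measurable_const).inter (measurableSet_survives s L _)).inter
          (measurableSet_lt measurable_const (measurable_pi_apply f))
      rw [hset, pi_apply_eq_lintegral_update rankMeasure f hSm]
      have hset2 : ∀ v : ℝ, {y | Function.update y f v ∈ {y : ι → ℝ |
          ((∀ u ∈ P.erase t, w < y u) ∧ survives s L (P.erase t) y) ∧ w < y f}} =
          {y | ((∀ u ∈ P.erase t, w < y u) ∧ survives s L (P.erase t) y) ∧ w < v} := by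
        intro v
        ext y
        simp only [Set.mem_ofPred_eq, Function.update_self, survives_update s hfL hfe]
        have : ∀ u ∈ P.erase t, Function.update y f v u = y u := fun u hu =>
          hne y v fun h => hfe (h ▸ hu)
        rw [forall₂_congr fun u hu => by rw [this u hu]]
      simp only [hset2]
      calc _ = ∫⁻ _ in Set.Ioi w, ENNReal.ofReal (survivalBound n L.length (1 - w))
            ∂rankMeasure := by
            rw [setLIntegral_const, rankMeasure_Ioi hw0, ENNReal.ofReal_mul (by linarith [hw.2]),
              mul_comm]
        _ ≤ ∫⁻ v in Set.Ioi w, μ {y | ((∀ u ∈ P.erase t, w < y u) ∧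
              survives s L (P.erase t) y) ∧ w < v} ∂rankMeasure := by
            refine setLIntegral_mono' measurableSet_Ioi fun v hv => ?_
            rw [← hcard]
            refine (ih hLn (fun g hg h => hLP' g hg (Finset.mem_of_mem_erase h))
              (Finset.mem_erase.2 ⟨hts.symm, hs⟩) hw0 hw.2).trans (measure_mono fun y hy => ?_)
            exact ⟨hy, hv⟩
        _ ≤ _ := setLIntegral_le_lintegral _ _
    have hdisj : Set.PairwiseDisjoint (↑(P.erase s)) B := by
      intro t ht t' ht' htt'
      refine Set.disjoint_left.2 fun y hy hy' => ?_
      exact lt_asymm (hy.2.1 t' (Finset.mem_erase.2 ⟨htt'.symm, Finset.mem_of_mem_erase ht'⟩))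
        (hy'.2.1 t (Finset.mem_erase.2 ⟨htt', Finset.mem_of_mem_erase ht⟩))
    have hdisjA : Disjoint A (⋃ t ∈ P.erase s, B t) := by
      refine Set.disjoint_left.2 fun y hy hy' => ?_
      obtain ⟨t, ht, hyt⟩ := Set.mem_iUnion₂.1 hy'
      exact lt_asymm (hy.2.1 t (Finset.mem_of_mem_erase ht)) hyt.2.2.1
    have hsub : A ∪ (⋃ t ∈ P.erase s, B t) ⊆
        {y | (∀ u ∈ P, θ < y u) ∧ survives s (f :: L) P y} := by
      rintro y (hy | hy)
      · exact ⟨hy.1, Or.inl hy.2⟩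
      · obtain ⟨t, ht, hyt⟩ := Set.mem_iUnion₂.1 hy
        refine ⟨fun u hu => ?_, Or.inr ⟨t, Finset.mem_of_mem_erase ht, Finset.ne_of_mem_erase ht,
          hyt.2⟩⟩
        by_cases h : u = t
        · exact h ▸ hyt.1
        · exact hyt.1.trans (hyt.2.1 u (Finset.mem_erase.2 ⟨h, hu⟩))
    refine le_trans ?_ (measure_mono hsub)
    rw [measure_union hdisjA (Finset.measurableSet_biUnion _ fun t _ => hBm t),
      measure_biUnion_finset hdisj fun t _ => hBm t]
    refine le_trans ?_ (add_le_add hμA (Finset.sum_le_sum hμB))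
    have hI : 0 ≤ ∫ w in θ..1, (1 - w) * survivalBound n L.length (1 - w) :=
      intervalIntegral.integral_nonneg h1 fun w hw => mul_nonneg (by linarith [hw.2])
        (survivalBound_nonneg _ _ (by linarith [hw.2]) (by linarith [hw.1]))
    have hI' : 0 ≤ ∫ w in θ..1, survivalBound (n + 1) L.length (1 - w) :=
      intervalIntegral.integral_nonneg h1 fun w hw =>
        survivalBound_nonneg _ _ (by linarith [hw.2]) (by linarith [hw.1])
    have hI'' : 0 ≤ θ * survivalBound (n + 1) L.length (1 - θ) :=
      mul_nonneg h0 (survivalBound_nonneg _ _ (by linarith) (by linarith))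
    rw [Finset.sum_const, Finset.card_erase_of_mem hs, hn, Nat.add_sub_cancel, nsmul_eq_mul,
      ← ENNReal.ofReal_natCast n, ← ENNReal.ofReal_mul (Nat.cast_nonneg n),
      ← ENNReal.ofReal_add hI'' hI',
      ← ENNReal.ofReal_add (add_nonneg hI'' hI') (mul_nonneg (Nat.cast_nonneg n) hI),
      List.length_cons]
    exact ENNReal.ofReal_le_ofReal (survivalBound_succ_le n L.length h0 h1)

/-! ### The hard instance for Ranking -/

/-- The old servers of the hard instance are those of index at least `k`. -/
def oldServers (k d : ℕ) : Finset (Fin (k + (d - 1))) := Finset.univ.filter fun s => k ≤ (s : ℕ)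

/-- The fresh server revealed by request `r`. -/
def freshServer {k : ℕ} (d : ℕ) (r : Fin (k * k)) : Fin (k + (d - 1)) :=
  ⟨(r : ℕ) % k, (Nat.mod_lt _ (Nat.pos_of_mul_pos_left (Fin.pos r))).trans_le (Nat.le_add_right _ _)⟩

/-- The `d - 1` old servers are neighbours of the first `k` requests, each of which has one more,
fresh neighbour; the later requests raise the degrees of the fresh servers to `k`. -/
abbrev hardInstance (k d : ℕ) : Instance where
  servers := k + (d - 1)
  requests := k * k
  nbrs r := insert (freshServer d r) (if (r : ℕ) < k then oldServers k d else ∅)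

theorem mem_oldServers {k d : ℕ} {s : Fin (k + (d - 1))} : s ∈ oldServers k d ↔ k ≤ (s : ℕ) := by
  simp [oldServers]

theorem card_oldServers (k d : ℕ) : (oldServers k d).card = d - 1 := by
  have : oldServers k d = Finset.univ.map (Fin.natAddEmb k) := by
    ext s
    simp only [mem_oldServers, Finset.mem_map, Finset.mem_univ, true_and, Fin.natAddEmb_apply]
    constructor
    · intro h
      exact ⟨⟨s - k, by omega⟩, Fin.ext (by simp; omega)⟩
    · rintro ⟨a, rfl⟩
      simp
  rw [this, Finset.card_map, Finset.card_univ, Fintype.card_fin]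

theorem freshServer_notMem_oldServers {k d : ℕ} (r : Fin (k * k)) :
    freshServer d r ∉ oldServers k d := by
  rw [mem_oldServers, not_le]
  exact Nat.mod_lt _ (Nat.pos_of_mul_pos_left (Fin.pos r))

theorem hardInstance_isBounded {k d : ℕ} (hd : 2 ≤ d) :
    (hardInstance k d).IsBounded k d := by
  constructor
  · intro s
    change Fin (k + (d - 1)) at s
    have key : ∀ g : Fin k → Fin (k * k), Function.Injective g →
        (∀ i, s ∈ (hardInstance k d).nbrs (g i)) → k ≤ (hardInstance k d).serverDegree s := by
      intro g hg hs
      have := Finset.card_le_card_of_injOn (s := Finset.univ)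
        (t := Finset.univ.filter fun r => s ∈ (hardInstance k d).nbrs r) g
        (fun i _ => by simpa using hs i) hg.injOn
      simpa [Instance.serverDegree] using this
    by_cases h : k ≤ (s : ℕ)
    · refine key (fun i => ⟨i, i.2.trans_le (Nat.le_mul_self k)⟩) (fun i j hij => ?_) fun i => ?_
      · exact Fin.ext (by simpa using hij)
      · refine Finset.mem_insert_of_mem ?_
        rw [if_pos i.2]
        exact mem_oldServers.2 h
    · push Not at h
      -- The fresh server `s` recurs in requests `s`, `s + k`, `s + 2k`, …, once in each block of
      -- `k`.
      refine key (fun i => ⟨s + k * i, ?_⟩) (fun i j hij => ?_) fun i => ?_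
      · calc (s : ℕ) + k * i < k + k * i := by omega
          _ = k * (i + 1) := by ring
          _ ≤ k * k := Nat.mul_le_mul_left k i.2
      · have : k * (i : ℕ) = k * j := by simpa using hij
        exact Fin.ext (Nat.eq_of_mul_eq_mul_left (by omega) this)
      · refine Finset.mem_insert.2 (Or.inl (Fin.ext ?_))
        simp [freshServer, Nat.mod_eq_of_lt h]
  · intro r
    refine (Finset.card_insert_le _ _).trans ?_
    split_ifs
    · have := card_oldServers k d
      rw [this]; omega
    · simp; omega

/-- Old servers use the first `d - 1 < k` requests, and fresh servers their second appearance, in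
the block from `k` to `2k - 1`; this block exists because `k ≥ 2`. -/
theorem servers_le_opt_hardInstance {k d : ℕ} (hd : 2 ≤ d) (hk : d < k) :
    k + (d - 1) ≤ (hardInstance k d).opt := by
  have h2 : k + k ≤ k * k := by nlinarith
  refine servers_le_opt (G := hardInstance k d) (fun s =>
    if h : (s : ℕ) < k then (⟨s + k, by omega⟩ : Fin (k * k))
    else (⟨s - k, by
      have := s.2
      change (s : ℕ) < k + (d - 1) at this
      change (s : ℕ) - k < k * k
      omega⟩ : Fin (k * k))) (fun s t hst => ?_) fun s => ?_
  · have hs := s.2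
    have ht := t.2
    change (s : ℕ) < k + (d - 1) at hs
    change (t : ℕ) < k + (d - 1) at ht
    dsimp only at hst
    refine Fin.ext ?_
    split_ifs at hst <;> have := congrArg Fin.val hst <;> dsimp only at this <;> omega
  · have hs := s.2
    change (s : ℕ) < k + (d - 1) at hs
    by_cases h : (s : ℕ) < k
    · rw [dif_pos h]
      refine Finset.mem_insert.2 (Or.inl (Fin.ext ?_))
      simp [freshServer, Nat.mod_eq_of_lt h]
    · rw [dif_neg h]
      refine Finset.mem_insert_of_mem ?_
      rw [if_pos (by dsimp only; omega)]
      exact mem_oldServers.2 (not_lt.1 h)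

/-! ### Ranking on the hard instance -/

theorem minRank_eq_singleton {m : ℕ} {y : Fin m → ℝ} {A : Finset (Fin m)} {g : Fin m} (hg : g ∈ A)
    (h : ∀ u ∈ A, u ≠ g → y g < y u) : minRank y A = {g} := by
  ext u
  simp only [minRank, Finset.mem_filter, Finset.mem_singleton]
  constructor
  · rintro ⟨hu, hmin⟩
    by_contra hne
    exact absurd (hmin g hg) (not_le.2 (h u hu hne))
  · rintro rfl
    refine ⟨hg, fun t ht => ?_⟩
    by_cases htu : t = u
    · rw [htu]
    · exact (h t ht htu).le

theorem rankingMatched_succ_of_minRank {G : Instance} {y : Fin G.servers → ℝ} {i : ℕ}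
    (hi : i < G.requests) {g : Fin G.servers}
    (hg : minRank y (G.nbrs ⟨i, hi⟩ \ rankingMatched G y i) = {g}) :
    rankingMatched G y (i + 1) = insert g (rankingMatched G y i) := by
  have hB : (minRank y (G.nbrs ⟨i, hi⟩ \ rankingMatched G y i)).Nonempty := by simp [hg]
  have hmin : (minRank y (G.nbrs ⟨i, hi⟩ \ rankingMatched G y i)).min' hB = g := by
    exact Finset.mem_singleton.1 (hg.subset (Finset.min'_mem _ hB))
  rw [rankingMatched]
  simp only [hi, dite_true, hB]
  rw [hmin]

theorem rankingMatched_succ_subset (G : Instance) (y : Fin G.servers → ℝ) {i : ℕ}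
    (hi : i < G.requests) :
    rankingMatched G y (i + 1) ⊆ rankingMatched G y i ∪ G.nbrs ⟨i, hi⟩ := by
  rw [rankingMatched]
  simp only [hi, dite_true]
  split_ifs with hB
  · refine Finset.insert_subset ?_ Finset.subset_union_left
    have := Finset.min'_mem _ hB
    exact Finset.mem_union_right _ (Finset.mem_sdiff.1 (Finset.mem_filter.1 this).1).1
  · exact Finset.subset_union_left

/-- The fresh servers revealed by the first `k` requests. -/
def freshList (k d : ℕ) : List (Fin (k + (d - 1))) := (List.finRange k).map (Fin.castAdd (d - 1))

theorem length_freshList (k d : ℕ) : (freshList k d).length = k := by simp [freshList]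

theorem nodup_freshList (k d : ℕ) : (freshList k d).Nodup :=
  (List.nodup_finRange k).map (Fin.castAdd_injective _ _)

theorem drop_freshList {k : ℕ} (d : ℕ) {i : ℕ} (hi : i < k) (hi' : i < k * k) :
    (freshList k d).drop i = freshServer d ⟨i, hi'⟩ :: (freshList k d).drop (i + 1) := by
  rw [List.drop_eq_getElem_cons (by rw [length_freshList]; exact hi)]
  congr 1
  refine Fin.ext ?_
  simp [freshList, freshServer, Nat.mod_eq_of_lt hi]

/-- The recursion of `survives` follows the run request by request. The second invariant is what
guarantees that the fresh server of the next request is still unmatched. -/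
theorem survives_rankingMatched {k d : ℕ} {s : Fin (k + (d - 1))}
    {y : Fin (k + (d - 1)) → ℝ} (hs : survives s (freshList k d) (oldServers k d) y) {i : ℕ}
    (hi : i ≤ k) :
    survives s ((freshList k d).drop i)
      (oldServers k d \ rankingMatched (hardInstance k d) y i) y ∧
      ∀ t ∈ rankingMatched (hardInstance k d) y i, (t : ℕ) < i ∨ k ≤ (t : ℕ) := by
  induction i with
  | zero =>
    refine ⟨?_, by simp [rankingMatched]⟩
    rw [rankingMatched]
    simpa using hs
  | succ i ih =>
    obtain ⟨ih1, ih2⟩ := ih (by omega)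
    have hik : i < k := hi
    have hi' : i < k * k := hik.trans_le (Nat.le_mul_self k)
    rw [drop_freshList d hik hi'] at ih1
    set f := freshServer d ⟨i, hi'⟩ with hf
    have hfi : (f : ℕ) = i := Nat.mod_eq_of_lt hik
    set M := rankingMatched (hardInstance k d) y i with hM
    have hN : (hardInstance k d).nbrs ⟨i, hi'⟩ = insert f (oldServers k d) := by
      change insert f (if i < k then oldServers k d else ∅) = _
      rw [if_pos hik]
    have hfM : f ∉ M := fun h => by
      have := ih2 f h
      omega
    have hA : (hardInstance k d).nbrs ⟨i, hi'⟩ \ M = insert f (oldServers k d \ M) := by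
      rw [hN, Finset.insert_sdiff_of_notMem _ hfM]
    have hfold : f ∉ oldServers k d := freshServer_notMem_oldServers _
    rcases ih1 with ⟨h1, h2⟩ | ⟨t, ht, hts, h1, h2, h3⟩
    · have hmin : minRank y ((hardInstance k d).nbrs ⟨i, hi'⟩ \ M) = {f} := by
        rw [hA]
        refine minRank_eq_singleton (Finset.mem_insert_self _ _) fun u hu hne => ?_
        exact h1 u (Finset.mem_of_mem_insert_of_ne hu hne)
      rw [rankingMatched_succ_of_minRank hi' hmin]
      constructor
      · have : oldServers k d \ insert f M = oldServers k d \ M := by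
          rw [Finset.sdiff_insert, Finset.erase_eq_of_notMem]
          exact fun h => hfold (Finset.mem_sdiff.1 h).1
        rw [← hM, this]
        exact h2
      · intro u hu
        rcases Finset.mem_insert.1 hu with rfl | hu
        · left; omega
        · have := ih2 u hu; omega
    · have hmin : minRank y ((hardInstance k d).nbrs ⟨i, hi'⟩ \ M) = {t} := by
        rw [hA]
        refine minRank_eq_singleton (Finset.mem_insert_of_mem ht) fun u hu hne => ?_
        rcases Finset.mem_insert.1 hu with rfl | hu
        · exact h2
        · exact h1 u (Finset.mem_erase.2 ⟨hne, hu⟩)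
      rw [rankingMatched_succ_of_minRank hi' hmin]
      constructor
      · rw [← hM, Finset.sdiff_insert]
        exact h3
      · intro u hu
        rcases Finset.mem_insert.1 hu with rfl | hu
        · right; exact mem_oldServers.1 (Finset.mem_sdiff.1 ht).1
        · have := ih2 u hu; omega

theorem notMem_rankingMatched {k d : ℕ} {s : Fin (k + (d - 1))}
    {y : Fin (k + (d - 1)) → ℝ} (hold : s ∈ oldServers k d)
    (hs : survives s (freshList k d) (oldServers k d) y) :
    s ∉ rankingMatched (hardInstance k d) y (k * k) := by
  have base : s ∉ rankingMatched (hardInstance k d) y k := by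
    have h := (survives_rankingMatched hs le_rfl).1
    rw [List.drop_of_length_le (length_freshList k d).le] at h
    exact (Finset.mem_sdiff.1 h).2
  have step : ∀ i, k ≤ i → i ≤ k * k → s ∉ rankingMatched (hardInstance k d) y i := by
    intro i hi
    induction i, hi using Nat.le_induction with
    | base => exact fun _ => base
    | succ i hki ih =>
      intro hik h
      have hik' : i < k * k := hik
      rcases Finset.mem_union.1 (rankingMatched_succ_subset (hardInstance k d) y hik' h) with h | h
      · exact ih hik'.le h
      · have hN : (hardInstance k d).nbrs ⟨i, hik'⟩ = {freshServer d ⟨i, hik'⟩} := by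
          change insert (freshServer d ⟨i, hik'⟩) (if i < k then oldServers k d else ∅) = _
          rw [if_neg (by omega)]
          rfl
        rw [hN, Finset.mem_singleton] at h
        exact freshServer_notMem_oldServers _ (h ▸ hold)
  exact step _ (Nat.le_mul_self k) le_rfl

theorem rankingValue_nonneg (G : Instance) : 0 ≤ rankingValue G :=
  integral_nonneg fun _ => Nat.cast_nonneg _

theorem rankingValue_hardInstance_le {k d : ℕ} (hd : 2 ≤ d) :
    rankingValue (hardInstance k d) ≤
      ((k : ℝ) + d - 1) - (1 - 1 / (d : ℝ)) ^ k * ((d : ℝ) - 1) := by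
  set μ : Measure (Fin (k + (d - 1)) → ℝ) := Measure.pi fun _ => rankMeasure with hμ
  set E : Fin (k + (d - 1)) → Set (Fin (k + (d - 1)) → ℝ) := fun s =>
    {y | survives s (freshList k d) (oldServers k d) y} with hE
  have hEm : ∀ s, MeasurableSet (E s) := fun s => measurableSet_survives _ _ _
  have hd1 : ((d - 1 : ℕ) : ℝ) = d - 1 := by push_cast [Nat.cast_sub (by omega : 1 ≤ d)]; ring
  have hprob : ∀ s ∈ oldServers k d, (1 - 1 / (d : ℝ)) ^ k ≤ μ.real (E s) := by
    intro s hs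
    have h := ofReal_survivalBound_le (nodup_freshList k d) (P := oldServers k d) (fun f hf => by
      obtain ⟨a, _, rfl⟩ := List.mem_map.1 hf
      rw [mem_oldServers]
      simp) hs le_rfl zero_le_one
    have h2 := h.trans (measure_mono (fun y hy => hy.2 :
      {y | (∀ u ∈ oldServers k d, (0 : ℝ) < y u) ∧
        survives s (freshList k d) (oldServers k d) y} ⊆ E s))
    rw [card_oldServers, length_freshList] at h2
    have h3 : survivalBound (d - 1) k (1 - 0) = (1 - 1 / (d : ℝ)) ^ k := by
      rw [survivalBound, hd1]; simp
    rw [h3] at h2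
    exact (ENNReal.ofReal_le_iff_le_toReal (measure_ne_top _ _)).1 h2
  have hint : ∀ s, Integrable ((E s).indicator fun _ => (1 : ℝ)) μ := fun s =>
    (integrable_const 1).indicator (hEm s)
  have hle : ∀ y : Fin (k + (d - 1)) → ℝ,
      ((rankingMatched (hardInstance k d) y (k * k)).card : ℝ) ≤
        ((k : ℝ) + d - 1) - ∑ s ∈ oldServers k d, (E s).indicator (fun _ => (1 : ℝ)) y := by
    intro y
    set M : Finset (Fin (k + (d - 1))) := rankingMatched (hardInstance k d) y (k * k)
    have h1 : ∑ s ∈ oldServers k d, (E s).indicator (fun _ => (1 : ℝ)) y ≤ (Mᶜ.card : ℝ) := by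
      classical
      simp only [Set.indicator_apply]
      rw [← Finset.sum_filter, Finset.sum_const, nsmul_eq_mul, mul_one]
      refine Nat.cast_le.2 (Finset.card_le_card fun s hs => ?_)
      rw [Finset.mem_filter] at hs
      exact Finset.mem_compl.2 (notMem_rankingMatched hs.1 hs.2)
    have h2 : ((M.card : ℕ) : ℝ) + Mᶜ.card = k + d - 1 := by
      have := Finset.card_add_card_compl M
      rw [Fintype.card_fin] at this
      rw [← Nat.cast_add, this]
      push_cast
      rw [hd1]; ring
    linarith
  have hmono : rankingValue (hardInstance k d) ≤ ∫ y, (((k : ℝ) + d - 1) -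
      ∑ s ∈ oldServers k d, (E s).indicator (fun _ => (1 : ℝ)) y) ∂μ := by
    -- Only the upper bound has to be integrable, so the measurability of the run of Ranking never
    -- enters.
    refine integral_mono_of_nonneg (Filter.Eventually.of_forall fun _ => Nat.cast_nonneg _) ?_
      (Filter.Eventually.of_forall hle)
    exact (integrable_const _).sub (integrable_finsetSum _ fun s _ => hint s)
  refine hmono.trans ?_
  rw [integral_sub (integrable_const _) (integrable_finsetSum _ fun s _ => hint s),
    integral_finsetSum _ fun s _ => hint s]
  simp only [integral_indicator_const _ (hEm _), integral_const, smul_eq_mul, mul_one,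
    probReal_univ, one_mul]
  refine sub_le_sub_left ?_ _
  calc (1 - 1 / (d : ℝ)) ^ k * ((d : ℝ) - 1) = ∑ _s ∈ oldServers k d, (1 - 1 / (d : ℝ)) ^ k := by
        rw [Finset.sum_const, card_oldServers, nsmul_eq_mul, hd1, mul_comm]
    _ ≤ _ := Finset.sum_le_sum hprob

theorem rankingRatio_le {k d : ℕ} (hd : 2 ≤ d) (hk : d < k) :
    rankingRatio k d ≤
      1 - (1 - 1 / (d : ℝ)) ^ k * ((d : ℝ) - 1) / ((k : ℝ) + (d : ℝ) - 1) := by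
  have hopt := servers_le_opt_hardInstance hd hk
  have hm : ((k + (d - 1) : ℕ) : ℝ) = (k : ℝ) + d - 1 := by
    rw [Nat.cast_add, Nat.cast_sub (by omega : 1 ≤ d)]; push_cast; ring
  have hopt' : (k : ℝ) + d - 1 ≤ (hardInstance k d).opt := by rw [← hm]; exact_mod_cast hopt
  have hpos : 0 < (k : ℝ) + d - 1 := by rw [← hm]; exact_mod_cast (by omega : 0 < k + (d - 1))
  have hv := rankingValue_hardInstance_le (k := k) hd
  have hbdd : BddBelow {x : ℝ | ∃ G : Instance, G.IsBounded k d ∧ 0 < G.opt ∧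
      x = rankingValue G / (G.opt : ℝ)} := by
    refine ⟨0, ?_⟩
    rintro x ⟨G, _, _, rfl⟩
    exact div_nonneg (rankingValue_nonneg G) (Nat.cast_nonneg _)
  refine (csInf_le hbdd ⟨hardInstance k d, hardInstance_isBounded hd, by omega, rfl⟩).trans ?_
  calc _ ≤ rankingValue (hardInstance k d) / ((k : ℝ) + d - 1) :=
        div_le_div_of_nonneg_left (rankingValue_nonneg _) hpos hopt'
    _ ≤ (((k : ℝ) + d - 1) - (1 - 1 / (d : ℝ)) ^ k * ((d : ℝ) - 1)) / ((k : ℝ) + d - 1) := by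
        gcongr
    _ = _ := by field_simp

theorem one_sub_rpow_le_ocsRatio {k d : ℕ} (hd : 10000 ≤ d) (hk : d < k) :
    1 - (1 / (3 * Real.exp 1)) ^ ((k : ℝ) / (d : ℝ)) ≤ ocsRatio k d := by
  have h3e : (0 : ℝ) < 3 * Real.exp 1 := by positivity
  refine le_trans ?_ (le_ocsRatio (by omega) ⟨hardInstance k d,
    hardInstance_isBounded (by omega), by
      have := servers_le_opt_hardInstance (k := k) (d := d) (by omega) hk
      omega⟩)
  rw [one_div, Real.inv_rpow h3e.le]
  exact sub_le_sub_left (inv_anti₀ (by positivity) (rpow_le_optimalCandidate hd hk.le)) 1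

/-! ### Comparison of the two bounds -/

/-- With `x = k / d > 1`, the right side is at least `exp (-1.002 x) / (1.01 (x + 1))` and the left
side is `exp (-x) · exp (-x log 3)`. The factor `exp (-x)` beats `1.01 (x + 1)`, and `log 3 > 1.002`
does the rest. -/
theorem rpow_lt_unmatched_bound {k d : ℕ} (hd : 10000 ≤ d) (hk : d < k) :
    (1 / (3 * Real.exp 1)) ^ ((k : ℝ) / (d : ℝ)) <
      (1 - 1 / (d : ℝ)) ^ k * ((d : ℝ) - 1) / ((k : ℝ) + (d : ℝ) - 1) := by
  have hdR : (10000 : ℝ) ≤ d := by exact_mod_cast hd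
  have hkR : (d : ℝ) < k := by exact_mod_cast hk
  have hd0 : (0 : ℝ) < d := by linarith
  have hd1 : (0 : ℝ) < (d : ℝ) - 1 := by linarith
  have h3e : (0 : ℝ) < 3 * Real.exp 1 := by positivity
  set x : ℝ := (k : ℝ) / d with hx
  have hkx : (k : ℝ) = x * d := by rw [hx]; field_simp
  have hx1 : 1 < x := (one_lt_div hd0).2 hkR
  have hu : 0 < 1 - 1 / (d : ℝ) := by
    rw [sub_pos, div_lt_one hd0]; linarith
  have hlog : -(x * (1 + 2 / 1000)) ≤ k * Real.log (1 - 1 / (d : ℝ)) := by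
    have h1 := Real.one_sub_inv_le_log_of_pos hu
    have e : 1 - (1 - 1 / (d : ℝ))⁻¹ = -(1 / (d - 1)) := by
      field_simp; ring
    rw [e] at h1
    have h2 := mul_le_mul_of_nonneg_left h1 (Nat.cast_nonneg k : (0 : ℝ) ≤ k)
    refine le_trans ?_ h2
    rw [mul_neg, neg_le_neg_iff, mul_one_div, div_le_iff₀ hd1, hkx]
    nlinarith
  have hpow : Real.exp (-(x * (1 + 2 / 1000))) ≤ (1 - 1 / (d : ℝ)) ^ k := by
    rw [← Real.exp_log (pow_pos hu k), Real.log_pow]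
    exact Real.exp_le_exp.2 hlog
  have hfrac : 1 / (1.01 * (x + 1)) ≤ ((d : ℝ) - 1) / (k + d - 1) := by
    rw [div_le_div_iff₀ (by positivity) (by linarith), hkx]
    nlinarith
  have hlhs : (1 / (3 * Real.exp 1)) ^ x = Real.exp (-(x * (1 + Real.log 3))) := by
    rw [Real.rpow_def_of_pos (by positivity), one_div, Real.log_inv,
      Real.log_mul (by norm_num) (Real.exp_pos 1).ne', Real.log_exp]
    ring_nf
  rw [hlhs, mul_div_assoc]
  refine lt_of_lt_of_le ?_ (mul_le_mul hpow hfrac (by positivity) (by positivity))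
  have hexp : 1.01 * (x + 1) < Real.exp x := by
    -- The tangent of `exp` at 1; for `x > 1` it is enough, as `e > 2.02`.
    have h1 : Real.exp 1 * x ≤ Real.exp x := by
      have h2 := Real.add_one_le_exp (x - 1)
      have h3 : Real.exp x = Real.exp 1 * Real.exp (x - 1) := by rw [← Real.exp_add]; ring_nf
      rw [h3]
      exact mul_le_mul_of_nonneg_left (by linarith) (Real.exp_pos 1).le
    nlinarith [Real.exp_one_gt_d9]
  rw [mul_one_div, lt_div_iff₀ (by positivity)]
  calc Real.exp (-(x * (1 + Real.log 3))) * (1.01 * (x + 1))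
      < Real.exp (-(x * (1 + Real.log 3))) * Real.exp x :=
        mul_lt_mul_of_pos_left hexp (Real.exp_pos _)
    _ = Real.exp (-(x * Real.log 3)) := by rw [← Real.exp_add]; ring_nf
    _ ≤ _ := Real.exp_le_exp.2 (by nlinarith [Real.log_three_gt_d9])

theorem tendsto_unmatched_bound {α : ℝ} (hα : 1 ≤ α) {k d : ℕ → ℕ}
    (hd : Filter.Tendsto d Filter.atTop Filter.atTop)
    (hkd : Filter.Tendsto (fun n => (k n : ℝ) / (d n : ℝ)) Filter.atTop (nhds α)) :
    Filter.Tendsto (fun n => (1 - 1 / (d n : ℝ)) ^ k n * ((d n : ℝ) - 1) /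
      ((k n : ℝ) + (d n : ℝ) - 1)) Filter.atTop (nhds (Real.exp (-α) / (α + 1))) := by
  have hinv : Filter.Tendsto (fun n => ((d n : ℝ))⁻¹) Filter.atTop (nhds 0) :=
    tendsto_inv_atTop_zero.comp (tendsto_natCast_atTop_atTop.comp hd)
  have h1 : Filter.Tendsto (fun n => ((1 - 1 / (d n : ℝ)) ^ d n) ^ ((k n : ℝ) / d n))
      Filter.atTop (nhds (Real.exp (-1) ^ α)) := by
    have h := (Real.tendsto_one_add_div_pow_exp (-1)).comp hd
    refine Filter.Tendsto.rpow (h.congr fun n => ?_) hkd (Or.inl (Real.exp_pos _).ne')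
    simp only [Function.comp, neg_div, ← sub_eq_add_neg]
  rw [← Real.exp_mul, neg_one_mul] at h1
  have h2 : Filter.Tendsto (fun n => (1 - ((d n : ℝ))⁻¹) / ((k n : ℝ) / d n + 1 - ((d n : ℝ))⁻¹))
      Filter.atTop (nhds ((1 - 0) / (α + 1 - 0))) :=
    (tendsto_const_nhds.sub hinv).div ((hkd.add_const 1).sub hinv) (by linarith)
  have h3 := h1.mul h2
  have e : Real.exp (-α) * ((1 - 0) / (α + 1 - 0)) = Real.exp (-α) / (α + 1) := by
    rw [sub_zero, sub_zero, mul_one_div]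
  rw [e] at h3
  refine h3.congr' ?_
  filter_upwards [hd.eventually_ge_atTop 2] with n hn
  have hn0 : (0 : ℝ) < d n := by exact_mod_cast (by omega : 0 < d n)
  have hn1 : (2 : ℝ) ≤ d n := by exact_mod_cast hn
  have hu : 0 ≤ 1 - 1 / (d n : ℝ) := by
    rw [sub_nonneg, div_le_one hn0]; linarith
  rw [mul_div_assoc]
  congr 1
  · rw [← Real.rpow_natCast, ← Real.rpow_mul hu, mul_div_cancel₀ _ hn0.ne', Real.rpow_natCast]
  · rw [← mul_div_mul_left _ _ hn0.ne']
    congr 1 <;> field_simp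

/-- After dividing by `exp (-α)` the claim is `α + 1 < 3^α`, which follows from `exp t ≥ 1 + t` at
`t = α log 3` and `log 3 > 1`. -/
theorem one_sub_exp_lt_one_sub_rpow {α : ℝ} (hα : 1 ≤ α) :
    1 - Real.exp (-α) / (α + 1) < 1 - (1 / (3 * Real.exp 1)) ^ α := by
  have h3 : (1 / (3 * Real.exp 1)) ^ α = Real.exp (-α) * Real.exp (-(α * Real.log 3)) := by
    rw [Real.rpow_def_of_pos (by positivity), one_div, Real.log_inv,
      Real.log_mul (by norm_num) (Real.exp_pos 1).ne', Real.log_exp, ← Real.exp_add]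
    ring_nf
  rw [h3, div_eq_mul_inv]
  refine sub_lt_sub_left (mul_lt_mul_of_pos_left ?_ (Real.exp_pos _)) 1
  rw [Real.exp_neg]
  refine inv_strictAnti₀ (by linarith) ?_
  have h1 : α + 1 < 1 + α * Real.log 3 := by nlinarith [Real.log_three_gt_d9]
  linarith [Real.add_one_le_exp (α * Real.log 3)]

end OnlineMatching

end

theorem mainTheorem10 :
    (∃ D : ℕ, ∀ d k : ℕ, D ≤ d → d < k →
      OnlineMatching.rankingRatio k d < OnlineMatching.ocsRatio k d ∧
      OnlineMatching.rankingRatio k d ≤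
        1 - (1 - 1 / (d : ℝ)) ^ k * ((d : ℝ) - 1) / ((k : ℝ) + (d : ℝ) - 1) ∧
      1 - (1 - 1 / (d : ℝ)) ^ k * ((d : ℝ) - 1) / ((k : ℝ) + (d : ℝ) - 1) <
        1 - (1 / (3 * Real.exp 1)) ^ ((k : ℝ) / (d : ℝ)) ∧
      1 - (1 / (3 * Real.exp 1)) ^ ((k : ℝ) / (d : ℝ)) ≤ OnlineMatching.ocsRatio k d) ∧
    (∀ α : ℝ, 1 ≤ α → ∀ k d : ℕ → ℕ, (∀ n, d n < k n) →
      Filter.Tendsto d Filter.atTop Filter.atTop →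
      Filter.Tendsto (fun n => (k n : ℝ) / (d n : ℝ)) Filter.atTop (nhds α) →
      ∀ ε : ℝ, 0 < ε → ∀ᶠ n in Filter.atTop,
        OnlineMatching.rankingRatio (k n) (d n) ≤ 1 - Real.exp (-α) / (α + 1) + ε ∧
        1 - (1 / (3 * Real.exp 1)) ^ α - ε ≤ OnlineMatching.ocsRatio (k n) (d n)) ∧
    (∀ α : ℝ, 1 ≤ α →
      1 - Real.exp (-α) / (α + 1) < 1 - (1 / (3 * Real.exp 1)) ^ α) := by
  refine ⟨⟨10000, fun d k hd hk => ?_⟩, fun α hα k d hdk hd hkd ε hε => ?_,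
    fun α hα => OnlineMatching.one_sub_exp_lt_one_sub_rpow hα⟩
  · have h1 := OnlineMatching.rankingRatio_le (by omega : 2 ≤ d) hk
    have h2 := sub_lt_sub_left (OnlineMatching.rpow_lt_unmatched_bound hd hk) 1
    have h3 := OnlineMatching.one_sub_rpow_le_ocsRatio hd hk
    exact ⟨(h1.trans_lt h2).trans_le h3, h1, h2, h3⟩
  · have h1 := OnlineMatching.tendsto_unmatched_bound hα hd hkd
    have h2 : Filter.Tendsto (fun n => (1 / (3 * Real.exp 1)) ^ ((k n : ℝ) / (d n : ℝ)))
        Filter.atTop (nhds ((1 / (3 * Real.exp 1)) ^ α)) :=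
      Filter.Tendsto.rpow tendsto_const_nhds hkd (Or.inl (by positivity))
    filter_upwards [hd.eventually_ge_atTop 10000, h1.eventually_const_lt (sub_lt_self _ hε),
      h2.eventually_lt_const (lt_add_of_pos_right _ hε)] with n hn hn1 hn2
    have h4 := OnlineMatching.rankingRatio_le (by omega : 2 ≤ d n) (hdk n)
    have h5 := OnlineMatching.one_sub_rpow_le_ocsRatio hn (hdk n)
    constructor <;> linarith
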